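/- Let $\mathcal H=L^2(0,1)\times L^2(0,1)$ (complex valued, with $\|\mathbf u\|_{\mathcal H}^2=\|u_1\|^2_{L^2}+\|u_2\|^2_{L^2}$). On $\mathcal D(\tilde L_0)=\{\mathbf u\in C^1[0,1]\times C^1[0,1]: u_1(0)=0\}$ put $$\tilde L_0\mathbf u(\rho)=\bigl(-\rho u_1'(\rho)+u_2'(\rho),\; u_1'(\rho)-\rho u_2'(\rho)\bigr),$$ the operator of the free radial wave equation in similarity coordinates. Then $\tilde L_0$ is closable, and its closure $L_0$ generates a (unique) strongly continuous one-parameter semigroup $S_0(\tau)$, $\tau\ge 0$, of bounded operators on $\mathcal H$. For $k\in\mathbb N_0$ let $$\mathcal H^{2k}=\{\mathbf u\in H^{2k}(0,1)\times H^{2k}(0,1): u_1^{(2j)}(0)=u_2^{(2j+1)}(0)=0 \text{ for } 0\le j<k\},$$ $D^{2k}\mathbf u=\mathbf u^{(2k)}$, $\|\mathbf u\|_{\mathcal H^{2k}}^2=\|\mathbf u\|_{\mathcal H}^2+\|D^{2k}\mathbf u\|_{\mathcal H}^2$, and $\mathcal N=\{\mathbf u\in\mathcal H^{2k}: D^{2k}\mathbf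 u=0\}$. For $j=1,\dots,2k$ let $\lambda_j=-j+1$, and let $\mathbf u(\cdot,\lambda_j)$ be the multiple by a positive constant, with $\|\mathbf u(\cdot,\lambda_j)\|_{\mathcal H^{2k}}=1$, of $$\bigl(\rho u'(\rho)+(\lambda_j-1)u(\rho),\; u'(\rho)\bigr),\qquad u(\rho)=(1-\rho)^{1-\lambda_j}-(1+\rho)^{1-\lambda_j}.$$ Each $\mathbf u(\cdot,\lambda_j)$ is analytic on $[0,1]$, lies in $\mathcal N$, and is an eigenfunction of $L_0$ with eigenvalue $\lambda_j$. Moreover, there is a constant $C>0$ depending only on $k$ such that for every $\mathbf u\in\mathcal H^{2k}$ there exist $c_1,\dots,c_{2k}\in\mathbb C$ and $\mathbf g\in\mathcal H^{2k}$ with $$\mathbf u=\sum_{j=1}^{2k}c_j\,\mathbf u(\cdot,\lambda_j)+\mathbf g$$ and, for all $\tau\ge 0$, $S_0(\tau)\mathbf g\in\mathcal H^{2k}$, $S_0(\tau)\mathbf u\in\mathcal H^{2k}$, $$\|S_0(\tau)\mathbf g\|_{\mathcal H^{2k}}\le C e^{(\frac12-2k)\tau}\|\mathbf g\|_{\mathcal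 H^{2k}},$$ $$\|S_0(\tau)\mathbf u\|_{\mathcal H^{2k}}\le C\Bigl(\sum_{j=1}^{2k}|c_j|e^{\lambda_j\tau}+e^{(\frac12-2k)\tau}\|\mathbf u\|_{\mathcal H^{2k}}\Bigr).$$ -/

import Mathlib

open MeasureTheory Filter Topology Set
open scoped NNReal ContDiff

noncomputable section

namespace FreeWave

/-! ### The energy space -/

/-- Lebesgue measure on the interval `(0,1)`. -/
abbrev unitMeasure : Measure ℝ := volume.restrict (Ioo (0 : ℝ) 1)

/-- The complex space `L²(0,1)`. -/
abbrev L2 : Type := Lp ℂ 2 unitMeasure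

/-- The energy space `L²(0,1) × L²(0,1)` with inner product `(u₁|v₁) + (u₂|v₂)`. -/
abbrev Energy : Type := WithLp 2 (L2 × L2)

theorem memLp_of_continuous {f : ℝ → ℂ} (hf : Continuous f) : MemLp f 2 unitMeasure := by
  obtain ⟨C, hC⟩ := isCompact_Icc.exists_bound_of_continuousOn
    (hf.continuousOn (s := Icc (0 : ℝ) 1))
  refine MemLp.of_bound hf.aestronglyMeasurable C ?_
  filter_upwards [ae_restrict_mem measurableSet_Ioo] with x hx
    using hC x (Ioo_subset_Icc_self hx)

/-! ### Weak derivatives and the spaces `𝓗^{2k}` -/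

/-- `g` is the `n`-th weak derivative of `f` on `(0,1)`. -/
def IsWeakDeriv (n : ℕ) (f g : L2) : Prop :=
  ∀ φ : ℝ → ℝ, ContDiff ℝ ∞ φ → HasCompactSupport φ → tsupport φ ⊆ Ioo 0 1 →
    ∫ x in Ioo (0 : ℝ) 1, ((iteratedDeriv n φ x : ℝ) : ℂ) * f x =
      (-1) ^ n * ∫ x in Ioo (0 : ℝ) 1, (φ x : ℂ) * g x

theorem IsWeakDeriv.unique {n : ℕ} {f g h : L2} (hg : IsWeakDeriv n f g)
    (hh : IsWeakDeriv n f h) : g = h := by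
  have hint : ∀ v : L2, Integrable v unitMeasure := fun v =>
    (Lp.memLp v).integrable (by norm_num)
  have hmul : ∀ (φ : ℝ → ℝ), Continuous φ → HasCompactSupport φ → ∀ v : L2,
      Integrable (fun x => (φ x : ℂ) * v x) unitMeasure := by
    intro φ hc hs v
    obtain ⟨C, hC⟩ := hc.bounded_above_of_compact_support hs
    refine (hint v).bdd_mul (c := C) (Complex.continuous_ofReal.comp hc).aestronglyMeasurable ?_
    exact Eventually.of_forall fun x => by simpa using hC x
  have key := isOpen_Ioo.ae_eq_zero_of_integral_contDiff_smul_eq_zero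
    (U := Ioo (0 : ℝ) 1) (μ := volume) (f := fun x => g x - h x)
    (IntegrableOn.locallyIntegrableOn ((hint g).sub (hint h))) (by
      intro φ hφ hs ht
      have e := (hg φ hφ hs ht).symm.trans (hh φ hφ hs ht)
      have e' := mul_left_cancel₀ (pow_ne_zero n (by norm_num : (-1 : ℂ) ≠ 0)) e
      have : ∫ x in Ioo (0 : ℝ) 1, φ x • (g x - h x) = 0 := by
        have h1 := integral_sub (hmul φ hφ.continuous hs g) (hmul φ hφ.continuous hs h)
        rw [e', sub_self] at h1
        rw [← h1]
        refine integral_congr_ae (Eventually.of_forall fun x => ?_)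
        simp [mul_sub]
      rw [← this, ← integral_indicator measurableSet_Ioo]
      congr 1
      ext x
      by_cases hx : x ∈ Ioo (0 : ℝ) 1
      · simp [indicator_of_mem hx]
      · have : φ x = 0 := by
          by_contra hne
          exact hx (ht (subset_tsupport φ hne))
        simp [indicator_of_notMem hx, this])
  apply Lp.ext
  have := (ae_restrict_iff' measurableSet_Ioo).2 key
  filter_upwards [this] with x hx using sub_eq_zero.1 hx

open Classical in
/-- The `n`-th weak derivative as an element of `L²(0,1)` (zero if there is none). -/
def weakDeriv (n : ℕ) (f : L2) : L2 :=
  if h : ∃ g, IsWeakDeriv n f g then h.choose else 0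

theorem IsWeakDeriv.weakDeriv_eq {n : ℕ} {f g : L2} (h : IsWeakDeriv n f g) :
    weakDeriv n f = g := by
  have hex : ∃ g, IsWeakDeriv n f g := ⟨g, h⟩
  rw [weakDeriv, dif_pos hex]
  exact hex.choose_spec.unique h

/-- The Sobolev space `H^m(0,1)`. -/
def MemSobolev (m : ℕ) (f : L2) : Prop :=
  ∀ n ≤ m, ∃ g, IsWeakDeriv n f g

/-- The continuous representative of `v` on `[0,1]` exists and vanishes at `0`. -/
def VanishesAtZero (v : L2) : Prop :=
  ∃ f : ℝ → ℂ, ContinuousOn f (Icc 0 1) ∧ v =ᵐ[unitMeasure] f ∧ f 0 = 0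

/-- The space `𝓗^{2k}`: both components lie in `H^{2k}(0,1)`, and
`u₁^{(2j)}(0) = u₂^{(2j+1)}(0) = 0` for all `0 ≤ j < k`. -/
def sobolevSpace (k : ℕ) : Set Energy :=
  {u | MemSobolev (2 * k) u.fst ∧ MemSobolev (2 * k) u.snd ∧
    ∀ j < k, VanishesAtZero (weakDeriv (2 * j) u.fst) ∧
      VanishesAtZero (weakDeriv (2 * j + 1) u.snd)}

/-- The operator `D^{2k}`, that is, `2k`-fold differentiation of both components. -/
def diffOp (k : ℕ) (u : Energy) : Energy :=
  WithLp.toLp 2 (weakDeriv (2 * k) u.fst, weakDeriv (2 * k) u.snd)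

/-- The norm of `𝓗^{2k}`, induced by the inner product `(u|v) + (D^{2k}u|D^{2k}v)`. -/
def sobolevNorm (k : ℕ) (u : Energy) : ℝ :=
  √(‖u‖ ^ 2 + ‖diffOp k u‖ ^ 2)

/-- The kernel `𝓝` of `D^{2k}` in `𝓗^{2k}`. -/
def kernelSpace (k : ℕ) : Set Energy :=
  {u | u ∈ sobolevSpace k ∧ diffOp k u = 0}

/-! ### The generator and its semigroup -/

/-- The functions `f₁, f₂` are in `C¹[0,1]`, `f₁(0) = 0`, they represent `u`, and
`(-ρ f₁' + f₂', f₁' - ρ f₂')` represents `v`. -/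
def IsClassicalPair (f₁ f₂ : ℝ → ℂ) (u v : Energy) : Prop :=
  ContDiffOn ℝ 1 f₁ (Icc 0 1) ∧ ContDiffOn ℝ 1 f₂ (Icc 0 1) ∧ f₁ 0 = 0 ∧
  u.fst =ᵐ[unitMeasure] f₁ ∧ u.snd =ᵐ[unitMeasure] f₂ ∧
  v.fst =ᵐ[unitMeasure] (fun ρ : ℝ =>
    -(ρ : ℂ) * derivWithin f₁ (Icc 0 1) ρ + derivWithin f₂ (Icc 0 1) ρ) ∧
  v.snd =ᵐ[unitMeasure] (fun ρ : ℝ =>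
    derivWithin f₁ (Icc 0 1) ρ - (ρ : ℂ) * derivWithin f₂ (Icc 0 1) ρ)

theorem derivWithin_facts {f g : ℝ → ℂ} (hf : ContDiffOn ℝ 1 f (Icc 0 1))
    (hg : ContDiffOn ℝ 1 g (Icc 0 1)) (c : ℂ) :
    (∀ᵐ ρ ∂unitMeasure, derivWithin (f + g) (Icc 0 1) ρ =
      derivWithin f (Icc 0 1) ρ + derivWithin g (Icc 0 1) ρ) ∧
    (∀ᵐ ρ ∂unitMeasure, derivWithin (c • f) (Icc 0 1) ρ = c * derivWithin f (Icc 0 1) ρ) := by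
  have hmem : ∀ᵐ ρ ∂unitMeasure, ρ ∈ Ioo (0 : ℝ) 1 := ae_restrict_mem measurableSet_Ioo
  constructor
  · filter_upwards [hmem] with ρ hρ
    exact derivWithin_add (hf.differentiableOn one_ne_zero ρ (Ioo_subset_Icc_self hρ))
      (hg.differentiableOn one_ne_zero ρ (Ioo_subset_Icc_self hρ))
  · filter_upwards [hmem] with ρ hρ
    exact derivWithin_const_smul c (hf.differentiableOn one_ne_zero ρ (Ioo_subset_Icc_self hρ))

/-- The graph of the operator `L̃₀`, with domain `{u ∈ C¹[0,1]² : u₁(0) = 0}` and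
`L̃₀ u = (-ρ u₁' + u₂', u₁' - ρ u₂')`. -/
def preGeneratorGraph : Submodule ℂ (Energy × Energy) where
  carrier := {p | ∃ f₁ f₂ : ℝ → ℂ, IsClassicalPair f₁ f₂ p.1 p.2}
  zero_mem' := by
    refine ⟨0, 0, contDiffOn_const, contDiffOn_const, rfl, ?_, ?_, ?_, ?_⟩
    · exact Lp.coeFn_zero ..
    · exact Lp.coeFn_zero ..
    · filter_upwards [Lp.coeFn_zero ℂ 2 unitMeasure] with x hx
      simpa using hx
    · filter_upwards [Lp.coeFn_zero ℂ 2 unitMeasure] with x hx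
      simpa using hx
  add_mem' := by
    rintro ⟨u, v⟩ ⟨u', v'⟩ ⟨f₁, f₂, h1, h2, h0, hu1, hu2, hv1, hv2⟩
      ⟨g₁, g₂, k1, k2, k0, ku1, ku2, kv1, kv2⟩
    have d1 := (derivWithin_facts h1 k1 0).1
    have d2 := (derivWithin_facts h2 k2 0).1
    refine ⟨f₁ + g₁, f₂ + g₂, h1.add k1, h2.add k2, by simp [h0, k0], ?_, ?_, ?_, ?_⟩
    · exact (Lp.coeFn_add u.fst u'.fst).trans (hu1.add ku1)
    · exact (Lp.coeFn_add u.snd u'.snd).trans (hu2.add ku2)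
    · refine (Lp.coeFn_add v.fst v'.fst).trans ((hv1.add kv1).trans ?_)
      filter_upwards [d1, d2] with ρ e1 e2
      rw [e1, e2]; simp only [Pi.add_apply]; ring
    · refine (Lp.coeFn_add v.snd v'.snd).trans ((hv2.add kv2).trans ?_)
      filter_upwards [d1, d2] with ρ e1 e2
      rw [e1, e2]; simp only [Pi.add_apply]; ring
  smul_mem' := by
    rintro c ⟨u, v⟩ ⟨f₁, f₂, h1, h2, h0, hu1, hu2, hv1, hv2⟩
    have d1 := (derivWithin_facts h1 h1 c).2
    have d2 := (derivWithin_facts h2 h2 c).2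
    refine ⟨c • f₁, c • f₂, h1.const_smul c, h2.const_smul c, by simp [h0], ?_, ?_, ?_, ?_⟩
    · exact (Lp.coeFn_smul c u.fst).trans (hu1.const_smul c)
    · exact (Lp.coeFn_smul c u.snd).trans (hu2.const_smul c)
    · refine (Lp.coeFn_smul c v.fst).trans ((hv1.const_smul c).trans ?_)
      filter_upwards [d1, d2] with ρ e1 e2
      rw [e1, e2]; simp only [Pi.smul_apply, smul_eq_mul]; ring
    · refine (Lp.coeFn_smul c v.snd).trans ((hv2.const_smul c).trans ?_)
      filter_upwards [d1, d2] with ρ e1 e2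
      rw [e1, e2]; simp only [Pi.smul_apply, smul_eq_mul]; ring

/-- The operator `L̃₀` on the energy space. -/
def preGenerator : Energy →ₗ.[ℂ] Energy := preGeneratorGraph.toLinearPMap

theorem derivWithin_eq_zero_of_ae {f : ℝ → ℂ} (hf : ContDiffOn ℝ 1 f (Icc 0 1))
    (h : (0 : ℝ → ℂ) =ᵐ[unitMeasure] f) :
    ∀ᵐ ρ ∂unitMeasure, derivWithin f (Icc 0 1) ρ = 0 := by
  have hEq : EqOn (0 : ℝ → ℂ) f (Ioo 0 1) :=
    Measure.eqOn_open_of_ae_eq h isOpen_Ioo continuousOn_const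
      (hf.continuousOn.mono Ioo_subset_Icc_self)
  filter_upwards [ae_restrict_mem (μ := volume) (measurableSet_Ioo (a := (0 : ℝ)) (b := 1))]
    with ρ hρ
  rw [derivWithin_of_mem_nhds (Icc_mem_nhds hρ.1 hρ.2)]
  have : f =ᶠ[𝓝 ρ] fun _ => 0 := by
    filter_upwards [Ioo_mem_nhds hρ.1 hρ.2] with x hx using (hEq hx).symm
  rw [this.deriv_eq]; simp

/-- `L̃₀` is single valued: its graph is the submodule it was built from. -/
theorem preGenerator_graph : preGenerator.graph = preGeneratorGraph := by
  refine Submodule.toLinearPMap_graph_eq _ ?_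
  rintro ⟨u, v⟩ ⟨f₁, f₂, h1, h2, -, hu1, hu2, hv1, hv2⟩ (rfl : u = 0)
  have d1 := derivWithin_eq_zero_of_ae h1 ((Lp.coeFn_zero ℂ 2 unitMeasure).symm.trans hu1)
  have d2 := derivWithin_eq_zero_of_ae h2 ((Lp.coeFn_zero ℂ 2 unitMeasure).symm.trans hu2)
  have z1 : v.fst = 0 := by
    apply Lp.ext
    filter_upwards [hv1, d1, d2, Lp.coeFn_zero ℂ 2 unitMeasure] with ρ a b c d
    rw [a, b, c, d]; simp
  have z2 : v.snd = 0 := by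
    apply Lp.ext
    filter_upwards [hv2, d1, d2, Lp.coeFn_zero ℂ 2 unitMeasure] with ρ a b c d
    rw [a, b, c, d]; simp
  exact WithLp.ofLp_injective 2 (Prod.ext z1 z2)

/-- The operator `L₀`, the closure of `L̃₀`. -/
def generator : Energy →ₗ.[ℂ] Energy := preGenerator.closure

/-- `S` is a strongly continuous one-parameter semigroup of bounded operators whose infinitesimal
generator is `A`: `x` is in the domain of `A` with `A x = y` if and only if
`(S(h)x - x)/h → y` as `h → 0+`. -/
structure IsSemigroupGeneratedBy (S : ℝ≥0 → Energy →L[ℂ] Energy) (A : Energy →ₗ.[ℂ] Energy) :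
    Prop where
  zero : S 0 = ContinuousLinearMap.id ℂ Energy
  add : ∀ s t, S (s + t) = (S s).comp (S t)
  continuous : ∀ x, Continuous fun t => S t x
  generator : ∀ x y, (x, y) ∈ A.graph ↔
    Tendsto (fun h : ℝ≥0 => (((h : ℝ)⁻¹ : ℝ) : ℂ) • (S h x - x)) (𝓝[>] 0) (𝓝 y)

/-! ### The analytic eigenfunctions -/

/-- The eigenvalue `λ_j = -j + 1`. -/
def eigval (j : ℕ) : ℝ := -(j : ℝ) + 1

/-- The function `u(ρ, λ_j) = (1-ρ)^{1-λ_j} - (1+ρ)^{1-λ_j}`, where `1 - λ_j = j`. -/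
def profile (j : ℕ) (ρ : ℝ) : ℝ := (1 - ρ) ^ j - (1 + ρ) ^ j

/-- `u₁(ρ, λ_j) = ρ u'(ρ, λ_j) + (λ_j - 1) u(ρ, λ_j)`. -/
def modeFst (j : ℕ) (ρ : ℝ) : ℂ := ((ρ * deriv (profile j) ρ + (eigval j - 1) * profile j ρ : ℝ) : ℂ)

/-- `u₂(ρ, λ_j) = u'(ρ, λ_j)`. -/
def modeSnd (j : ℕ) (ρ : ℝ) : ℂ := ((deriv (profile j) ρ : ℝ) : ℂ)

theorem contDiff_profile (j : ℕ) : ContDiff ℝ 1 (profile j) := by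
  unfold profile; fun_prop

theorem continuous_modeFst (j : ℕ) : Continuous (modeFst j) := by
  have h1 := (contDiff_profile j).continuous_deriv le_rfl
  have h2 := (contDiff_profile j).continuous
  unfold modeFst; fun_prop

theorem continuous_modeSnd (j : ℕ) : Continuous (modeSnd j) := by
  have h1 := (contDiff_profile j).continuous_deriv le_rfl
  unfold modeSnd; fun_prop

/-- The function `(u₁(·, λ_j), u₂(·, λ_j))` as an element of the energy space. -/
def rawMode (j : ℕ) : Energy :=
  WithLp.toLp 2 ((memLp_of_continuous (continuous_modeFst j)).toLp (modeFst j),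
    (memLp_of_continuous (continuous_modeSnd j)).toLp (modeSnd j))

/-- The eigenfunction `𝐮(·, λ_j)`, normalized in `𝓗^{2k}`. -/
def mode (k j : ℕ) : Energy := (((sobolevNorm k (rawMode j))⁻¹ : ℝ) : ℂ) • rawMode j

/-- `u` has a representative which is analytic on (a neighbourhood of) `[0,1]`. -/
def IsAnalytic (u : Energy) : Prop :=
  ∃ f₁ f₂ : ℝ → ℂ, AnalyticOnNhd ℝ f₁ (Icc 0 1) ∧ AnalyticOnNhd ℝ f₂ (Icc 0 1) ∧
    u.fst =ᵐ[unitMeasure] f₁ ∧ u.snd =ᵐ[unitMeasure] f₂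

end FreeWave

end

noncomputable section

namespace FreeWave

/-! ### Weighted composition operators -/

/-! Extend `u₁` oddly and `u₂` evenly in `ρ` and put `y = 1 - ρ`. The pair then becomes one function
`w` on `(0,2)`, with `w(1 - ρ) = u₂ + u₁` and `w(1 + ρ) = u₂ - u₁`. In this half-wave picture `L₀`
is `-y ∂_y`, the semigroup is the dilation `w(y) ↦ w(e^{-τ} y)` with norm at most `e^{τ/2}` on
`L²(0,2)`, and the mode with index `j` is a multiple of `y^{j-1}`. The boundary conditions in
`𝓗^{2k}` are the parity conditions that let `w` have `2k` weak derivatives across `y = 1`, and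
`D^{2k}` becomes `∂_y^{2k}`.

The decomposition is Taylor's formula at `y = 0`: `w = ∑_{m<2k} c_m y^m + V^{2k} D^{2k} w`, with `V`
integration from `0` (`exists_taylor`). Since `S_τ V = e^{-τ} V S_τ` (`semigroup_volterra`), the
remainder `g = V^{2k} D^{2k} u` decays like `e^{-2kτ} e^{τ/2}`, both in energy and after applying
`D^{2k}`. Conversely, every expression of Taylor form lies in `𝓗^{2k}`
(`mem_sobolevSpace_of_taylor`), so the evolution preserves the space.

Polynomials are dense, so identities between bounded operators need checking only on the monomials
`mono m` (`ext_mono`). Generation combines this density with closedness of the infinitesimal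
generator (`isClosed_generatesAt`) and a resolvent estimate at `1` (`GeneratesAt.norm_le`).
Uniqueness is `IsC0Semigroup.eq_of_generatesAt`. -/

theorem exists_weightedComp {μ ν : Measure ℝ} {φ : ℝ → ℝ} {m : ℝ → ℂ} {B : ℝ} {c : ℝ≥0}
    (hφ : Measurable φ) (hm : Measurable m) (hB0 : 0 ≤ B) (hB : ∀ᵐ x ∂ν, ‖m x‖ ≤ B)
    (hc : ν.map φ ≤ c • μ) :
    ∃ T : Lp ℂ 2 μ →L[ℂ] Lp ℂ 2 ν, (∀ f, T f =ᵐ[ν] fun x => m x * f (φ x)) ∧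
      ‖T‖ ≤ B * √c := by
  have hac : ν.map φ ≪ μ := (Measure.absolutelyContinuous_of_le hc).trans
    (Measure.smul_absolutelyContinuous)
  have hq : ∀ {p : ℝ → Prop}, (∀ᵐ y ∂μ, p y) → ∀ᵐ x ∂ν, p (φ x) := fun {p} h =>
    ae_of_ae_map hφ.aemeasurable (hac.ae_le h)
  have hcomp : ∀ f : Lp ℂ 2 μ, AEStronglyMeasurable (fun x => f (φ x)) ν := fun f =>
    (((Lp.aestronglyMeasurable f).mono_ac hac).comp_measurable hφ)
  have hnorm : ∀ f : Lp ℂ 2 μ, eLpNorm (fun x => m x * f (φ x)) 2 ν ≤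
      ENNReal.ofReal (B * √c) * eLpNorm f 2 μ := by
    intro f
    have h1 : eLpNorm (fun x => m x * f (φ x)) 2 ν ≤
        ENNReal.ofReal B * eLpNorm (fun x => f (φ x)) 2 ν := by
      refine eLpNorm_le_mul_eLpNorm_of_ae_le_mul ?_ 2
      filter_upwards [hB] with x hx
      rw [norm_mul]
      gcongr
    have h2 : eLpNorm (fun x => f (φ x)) 2 ν ≤ ENNReal.ofReal (√c) * eLpNorm f 2 μ := by
      have := eLpNorm_map_measure (p := 2) ((Lp.aestronglyMeasurable f).mono_ac hac) hφ.aemeasurable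
      change eLpNorm (f ∘ φ) 2 ν ≤ _
      rw [← this]
      refine (eLpNorm_mono_measure _ hc).trans ?_
      have := eLpNorm_smul_measure_of_ne_top (p := 2) (by norm_num) f (c : ENNReal) (μ := μ)
      change eLpNorm f 2 ((c : ENNReal) • μ) ≤ _
      rw [this, smul_eq_mul]
      gcongr
      rw [Real.sqrt_eq_rpow, ← ENNReal.ofReal_rpow_of_nonneg (NNReal.coe_nonneg c) (by norm_num : (0 : ℝ) ≤ 1 / 2)]
      norm_num
    calc _ ≤ _ := h1
      _ ≤ ENNReal.ofReal B * (ENNReal.ofReal (√c) * eLpNorm f 2 μ) := by gcongr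
      _ = _ := by rw [← mul_assoc, ENNReal.ofReal_mul hB0]
  have hmem : ∀ f : Lp ℂ 2 μ, MemLp (fun x => m x * f (φ x)) 2 ν := fun f =>
    ⟨hm.aestronglyMeasurable.mul (hcomp f), (hnorm f).trans_lt
      (ENNReal.mul_lt_top ENNReal.ofReal_lt_top (Lp.eLpNorm_lt_top f))⟩
  let T : Lp ℂ 2 μ →ₗ[ℂ] Lp ℂ 2 ν :=
    { toFun := fun f => (hmem f).toLp _
      map_add' := by
        intro f g
        apply Lp.ext
        filter_upwards [(hmem (f + g)).coeFn_toLp, (hmem f).coeFn_toLp, (hmem g).coeFn_toLp,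
          Lp.coeFn_add ((hmem f).toLp _) ((hmem g).toLp _), hq (Lp.coeFn_add f g)]
          with x h1 h2 h3 h4 h5
        rw [h1, h4, Pi.add_apply, h2, h3, h5, Pi.add_apply]; ring
      map_smul' := by
        intro a f
        apply Lp.ext
        filter_upwards [(hmem (a • f)).coeFn_toLp, (hmem f).coeFn_toLp,
          Lp.coeFn_smul a ((hmem f).toLp _), hq (Lp.coeFn_smul a f)]
          with x h1 h2 h4 h5
        simp only [RingHom.id_apply]
        rw [h1, h4, Pi.smul_apply, h2, h5, Pi.smul_apply]; simp only [smul_eq_mul]; ring }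
  have hT : ∀ f, ‖T f‖ ≤ B * √c * ‖f‖ := by
    intro f
    change ‖(hmem f).toLp _‖ ≤ _
    rw [Lp.norm_toLp, Lp.norm_def, ← ENNReal.toReal_ofReal (by positivity : 0 ≤ B * √c),
      ← ENNReal.toReal_mul]
    exact ENNReal.toReal_mono
      (ENNReal.mul_lt_top ENNReal.ofReal_lt_top (Lp.eLpNorm_lt_top f)).ne (hnorm f)
  exact ⟨T.mkContinuous _ hT, fun f => (hmem f).coeFn_toLp,
    T.mkContinuous_norm_le (by positivity) hT⟩

/-- An affine substitution scales Lebesgue measure by `|a|⁻¹`. The image of `s` need not fill `t`,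
hence an inequality. -/
theorem map_affine_restrict_le {a b : ℝ} (ha : a ≠ 0) {s t : Set ℝ}
    (h : ∀ x ∈ s, a * x + b ∈ t) :
    (volume.restrict s).map (fun x => a * x + b) ≤ (‖a⁻¹‖₊ : ℝ≥0) • volume.restrict t := by
  have hφ : Measurable fun x : ℝ => a * x + b := by fun_prop
  refine Measure.le_iff.2 fun r hr => ?_
  rw [Measure.map_apply hφ hr, Measure.restrict_apply (hφ hr), Measure.smul_apply,
    Measure.restrict_apply hr]
  calc volume ((fun x => a * x + b) ⁻¹' r ∩ s)
      ≤ volume ((fun x => a * x) ⁻¹' ((fun x => x + b) ⁻¹' (r ∩ t))) :=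
        measure_mono fun x hx => ⟨hx.1, h x hx.2⟩
    _ = _ := by
      rw [Real.volume_preimage_mul_left ha, measure_preimage_add_right, ENNReal.smul_def,
        smul_eq_mul]
      congr 1
      rw [← Real.norm_eq_abs, ofReal_norm]; rfl

/-! ### The half-wave picture: the energy space as `L²(0,2)` -/

/-- Lebesgue measure on the interval `(0,2)`. -/
abbrev doubleMeasure : Measure ℝ := volume.restrict (Ioo (0 : ℝ) 2)

/-- The map folds `(0,2)` two-to-one onto `(0,1)`, up to the null point `y = 1`; the two branches
give the factor `2`. -/
theorem map_abs_one_sub_le :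
    doubleMeasure.map (fun y => |1 - y|) ≤ (2 : ℝ≥0) • unitMeasure := by
  have hφ : Measurable fun x : ℝ => |1 - x| := by fun_prop
  refine Measure.le_iff.2 fun r hr => ?_
  rw [Measure.map_apply hφ hr, Measure.restrict_apply (hφ hr), Measure.smul_apply,
    Measure.restrict_apply hr]
  have hsub : (fun x : ℝ => |1 - x|) ⁻¹' r ∩ Ioo 0 2 ⊆
      ((fun x => 1 - x) ⁻¹' (r ∩ Ioo 0 1) ∪ (fun x => x - 1) ⁻¹' (r ∩ Ioo 0 1)) ∪ {1} := by
    rintro x ⟨hx, hx0, hx2⟩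
    rcases lt_trichotomy x 1 with h | h | h
    · left; left
      have : |1 - x| = 1 - x := abs_of_pos (by linarith)
      exact ⟨by simpa [this] using hx, by simp only [mem_Ioo]; constructor <;> linarith⟩
    · right; exact h
    · left; right
      have : |1 - x| = x - 1 := by rw [abs_of_neg (by linarith)]; ring
      exact ⟨by simpa [this] using hx, by simp only [mem_Ioo]; constructor <;> linarith⟩
  refine (measure_mono hsub).trans ((measure_union_le _ _).trans ?_)
  rw [Real.volume_singleton, add_zero]
  refine (measure_union_le _ _).trans ?_
  have e1 : volume ((fun x : ℝ => 1 - x) ⁻¹' (r ∩ Ioo 0 1)) = volume (r ∩ Ioo (0 : ℝ) 1) :=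
    (Measure.measurePreserving_sub_left volume (1 : ℝ)).measure_preimage
      (hr.inter measurableSet_Ioo).nullMeasurableSet
  have e2 : volume ((fun x : ℝ => x - 1) ⁻¹' (r ∩ Ioo 0 1)) = volume (r ∩ Ioo (0 : ℝ) 1) :=
    (measurePreserving_sub_right volume (1 : ℝ)).measure_preimage
      (hr.inter measurableSet_Ioo).nullMeasurableSet
  rw [e1, e2, ENNReal.smul_def, smul_eq_mul, ← two_mul]
  rfl

/-- The odd part of `(1 - ρ) ^ m`. -/
def monoFst (m : ℕ) (ρ : ℝ) : ℂ := ((1 - (ρ : ℂ)) ^ m - (1 + (ρ : ℂ)) ^ m) / 2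

/-- The even part of `(1 - ρ) ^ m`. -/
def monoSnd (m : ℕ) (ρ : ℝ) : ℂ := ((1 - (ρ : ℂ)) ^ m + (1 + (ρ : ℂ)) ^ m) / 2

theorem continuous_monoFst (m : ℕ) : Continuous (monoFst m) := by unfold monoFst; fun_prop

theorem continuous_monoSnd (m : ℕ) : Continuous (monoSnd m) := by unfold monoSnd; fun_prop

/-- The element of the energy space with half-wave profile `y ^ m`. -/
def mono (m : ℕ) : Energy :=
  WithLp.toLp 2 ((memLp_of_continuous (continuous_monoFst m)).toLp (monoFst m),
    (memLp_of_continuous (continuous_monoSnd m)).toLp (monoSnd m))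

theorem mono_fst_ae (m : ℕ) : (mono m).fst =ᵐ[unitMeasure] monoFst m := MemLp.coeFn_toLp (memLp_of_continuous (continuous_monoFst m))

theorem mono_snd_ae (m : ℕ) : (mono m).snd =ᵐ[unitMeasure] monoSnd m := MemLp.coeFn_toLp (memLp_of_continuous (continuous_monoSnd m))

theorem energy_ext {u v : Energy} (h1 : u.fst =ᵐ[unitMeasure] v.fst)
    (h2 : u.snd =ᵐ[unitMeasure] v.snd) : u = v :=
  WithLp.ofLp_injective 2 (Prod.ext (Lp.ext h1) (Lp.ext h2))

/-- A pair of operators as an operator into the energy space. -/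
def pairOp {X : Type*} [NormedAddCommGroup X] [NormedSpace ℂ X] (A B : X →L[ℂ] L2) :
    X →L[ℂ] Energy :=
  ((WithLp.prodContinuousLinearEquiv 2 ℂ L2 L2).symm : (L2 × L2) →L[ℂ] Energy).comp (A.prod B)

@[simp] theorem pairOp_fst {X : Type*} [NormedAddCommGroup X] [NormedSpace ℂ X]
    (A B : X →L[ℂ] L2) (x : X) : (pairOp A B x).fst = A x := rfl

@[simp] theorem pairOp_snd {X : Type*} [NormedAddCommGroup X] [NormedSpace ℂ X]
    (A B : X →L[ℂ] L2) (x : X) : (pairOp A B x).snd = B x := rfl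

/-- The first component. -/
def fstOp : Energy →L[ℂ] L2 :=
  (ContinuousLinearMap.fst ℂ L2 L2).comp (WithLp.prodContinuousLinearEquiv 2 ℂ L2 L2 : Energy →L[ℂ] L2 × L2)

/-- The second component. -/
def sndOp : Energy →L[ℂ] L2 :=
  (ContinuousLinearMap.snd ℂ L2 L2).comp (WithLp.prodContinuousLinearEquiv 2 ℂ L2 L2 : Energy →L[ℂ] L2 × L2)

@[simp] theorem fstOp_apply (u : Energy) : fstOp u = u.fst := rfl

@[simp] theorem sndOp_apply (u : Energy) : sndOp u = u.snd := rfl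

theorem memLp_pow (m : ℕ) : MemLp (fun y : ℝ => (y : ℂ) ^ m) 2 doubleMeasure := by
  refine MemLp.of_bound (by fun_prop) (2 ^ m) ?_
  filter_upwards [ae_restrict_mem measurableSet_Ioo] with x hx
  rw [norm_pow, Complex.norm_real, Real.norm_of_nonneg hx.1.le]
  exact pow_le_pow_left₀ hx.1.le hx.2.le m

/-- Unfolding to half-waves on `(0,2)`. -/
theorem exists_unfold : ∃ E : Energy →L[ℂ] Lp ℂ 2 doubleMeasure,
    ∀ u : Energy, E u =ᵐ[doubleMeasure]
      fun y => u.snd |1 - y| + (SignType.sign (1 - y) : ℝ) * u.fst |1 - y| := by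
  obtain ⟨A, hA, -⟩ := exists_weightedComp (m := fun _ => 1) (B := 1)
    (by fun_prop) measurable_const zero_le_one (by simp) map_abs_one_sub_le
  obtain ⟨B, hB, -⟩ := exists_weightedComp
    (m := fun y => (((SignType.sign (1 - y) : SignType) : ℝ) : ℂ)) (B := 1)
    (by fun_prop) (by
      refine Complex.measurable_ofReal.comp ?_
      have : (fun y : ℝ => ((SignType.sign (1 - y) : SignType) : ℝ)) = fun y =>
          if y < 1 then 1 else if y = 1 then 0 else -1 := by
        ext y
        rcases lt_trichotomy y 1 with h | h | h
        · simp [h]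
        · simp [h]
        · simp [h.not_gt, h.ne', sign_neg (by linarith : 1 - y < 0)]
      rw [this]
      exact Measurable.ite measurableSet_Iio measurable_const
        (Measurable.ite (measurableSet_singleton 1) measurable_const measurable_const))
    zero_le_one (by
      refine Eventually.of_forall fun y => ?_
      rcases lt_trichotomy (1 - y) 0 with h | h | h <;> simp [h]) map_abs_one_sub_le
  refine ⟨A.comp sndOp + B.comp fstOp, fun u => ?_⟩
  filter_upwards [hA u.snd, hB u.fst, Lp.coeFn_add (A u.snd) (B u.fst)] with y h1 h2 h3
  have : (A.comp sndOp + B.comp fstOp) u = A u.snd + B u.fst := rfl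
  rw [this, h3, Pi.add_apply, h1, h2, one_mul]

/-- Folding half-waves on `(0,2)`. -/
theorem exists_fold : ∃ Q : Lp ℂ 2 doubleMeasure →L[ℂ] Energy, ∀ w,
    (Q w).fst =ᵐ[unitMeasure] (fun ρ => (w (1 - ρ) - w (1 + ρ)) / 2) ∧
    (Q w).snd =ᵐ[unitMeasure] (fun ρ => (w (1 - ρ) + w (1 + ρ)) / 2) := by
  obtain ⟨A, hA, -⟩ := exists_weightedComp (m := fun _ => 1 / 2) (B := 1)
    (by fun_prop) measurable_const zero_le_one (by simp; norm_num)
    (map_affine_restrict_le (a := -1) (b := 1) (s := Ioo (0 : ℝ) 1) (t := Ioo (0 : ℝ) 2)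
      (by norm_num)
      (by rintro x ⟨h1, h2⟩; simp only [mem_Ioo]; constructor <;> linarith))
  obtain ⟨B, hB, -⟩ := exists_weightedComp (m := fun _ => 1 / 2) (B := 1)
    (by fun_prop) measurable_const zero_le_one (by simp; norm_num)
    (map_affine_restrict_le (a := 1) (b := 1) (s := Ioo (0 : ℝ) 1) (t := Ioo (0 : ℝ) 2)
      (by norm_num)
      (by rintro x ⟨h1, h2⟩; simp only [mem_Ioo]; constructor <;> linarith))
  refine ⟨pairOp (A - B) (A + B), fun w => ⟨?_, ?_⟩⟩
  · filter_upwards [hA w, hB w, Lp.coeFn_sub (A w) (B w)] with ρ h1 h2 h3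
    rw [pairOp_fst, sub_apply, h3, Pi.sub_apply, h1, h2]
    rw [show -1 * ρ + 1 = 1 - ρ by ring, show 1 * ρ + 1 = 1 + ρ by ring]; ring
  · filter_upwards [hA w, hB w, Lp.coeFn_add (A w) (B w)] with ρ h1 h2 h3
    rw [pairOp_snd, add_apply, h3, Pi.add_apply, h1, h2]
    rw [show -1 * ρ + 1 = 1 - ρ by ring, show 1 * ρ + 1 = 1 + ρ by ring]; ring

theorem ae_affine {a b : ℝ} (ha : a ≠ 0) {s t : Set ℝ}
    (h : ∀ x ∈ s, a * x + b ∈ t) {p : ℝ → Prop} (hp : ∀ᵐ y ∂volume.restrict t, p y) :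
    ∀ᵐ x ∂volume.restrict s, p (a * x + b) :=
  ae_of_ae_map (by fun_prop)
    (((Measure.absolutelyContinuous_of_le (map_affine_restrict_le ha h)).trans
      Measure.smul_absolutelyContinuous).ae_le hp)

theorem ae_one_sub {p : ℝ → Prop} (hp : ∀ᵐ y ∂doubleMeasure, p y) :
    ∀ᵐ ρ ∂unitMeasure, p (1 - ρ) := by
  have := ae_affine (a := -1) (b := 1) (s := Ioo (0 : ℝ) 1) (by norm_num)
    (by rintro x ⟨h1, h2⟩; simp only [mem_Ioo]; constructor <;> linarith) hp
  filter_upwards [this] with ρ h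
  rwa [show 1 - ρ = -1 * ρ + 1 by ring]

theorem ae_one_add {p : ℝ → Prop} (hp : ∀ᵐ y ∂doubleMeasure, p y) :
    ∀ᵐ ρ ∂unitMeasure, p (1 + ρ) := by
  have := ae_affine (a := 1) (b := 1) (s := Ioo (0 : ℝ) 1) (by norm_num)
    (by rintro x ⟨h1, h2⟩; simp only [mem_Ioo]; constructor <;> linarith) hp
  filter_upwards [this] with ρ h
  rwa [show 1 + ρ = 1 * ρ + 1 by ring]

/-- Half the sum and half the difference of `u₂ + u₁` and `u₂ - u₁` recover `u`. This transfers both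
the dilation and the density of polynomials from `L²(0,2)` to the energy space. -/
theorem exists_fold_unfold : ∃ (E : Energy →L[ℂ] Lp ℂ 2 doubleMeasure)
    (Q : Lp ℂ 2 doubleMeasure →L[ℂ] Energy), (∀ u, Q (E u) = u) ∧
    (∀ m, E (mono m) = (memLp_pow m).toLp) ∧ ∀ m, Q (memLp_pow m).toLp = mono m := by
  obtain ⟨E, hE⟩ := exists_unfold
  obtain ⟨Q, hQ⟩ := exists_fold
  have hQm : ∀ m, Q (memLp_pow m).toLp = mono m := by
    intro m
    have c1 := ae_one_sub (memLp_pow m).coeFn_toLp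
    have c2 := ae_one_add (memLp_pow m).coeFn_toLp
    apply energy_ext
    · filter_upwards [(hQ (memLp_pow m).toLp).1, mono_fst_ae m, c1, c2] with ρ h1 h2 h3 h4
      rw [h1, h2, h3, h4, monoFst]; push_cast; ring
    · filter_upwards [(hQ (memLp_pow m).toLp).2, mono_snd_ae m, c1, c2] with ρ h1 h2 h3 h4
      rw [h1, h2, h3, h4, monoSnd]; push_cast; ring
  have habs : ∀ {p : ℝ → Prop}, (∀ᵐ ρ ∂unitMeasure, p ρ) → ∀ᵐ y ∂doubleMeasure, p |1 - y| :=
    fun {p} hp => ae_of_ae_map (by fun_prop)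
      (((Measure.absolutelyContinuous_of_le map_abs_one_sub_le).trans
        Measure.smul_absolutelyContinuous).ae_le hp)
  refine ⟨E, Q, fun u => ?_, fun m => ?_, hQm⟩
  · have c1 := ae_one_sub (hE u)
    have c2 := ae_one_add (hE u)
    have hmem : ∀ᵐ ρ ∂unitMeasure, ρ ∈ Ioo (0 : ℝ) 1 := ae_restrict_mem measurableSet_Ioo
    apply energy_ext
    · filter_upwards [(hQ (E u)).1, c1, c2, hmem] with ρ h1 h3 h4 h5
      rw [h1, h3, h4]
      simp [abs_of_pos h5.1, sign_pos h5.1, sign_neg (neg_lt_zero.2 h5.1)]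
    · filter_upwards [(hQ (E u)).2, c1, c2, hmem] with ρ h1 h3 h4 h5
      rw [h1, h3, h4]
      simp [abs_of_pos h5.1, sign_pos h5.1, sign_neg (neg_lt_zero.2 h5.1)]
      ring
  · apply Lp.ext
    filter_upwards [hE (mono m), (memLp_pow m).coeFn_toLp, habs (mono_fst_ae m),
      habs (mono_snd_ae m)] with y h1 h2 h3 h4
    rw [h1, h2, h3, h4, monoFst, monoSnd]
    rcases lt_trichotomy y 1 with h | h | h
    · rw [abs_of_pos (by linarith), sign_pos (by linarith)]
      push_cast; simp; ring
    · simp [h]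
    · rw [abs_of_neg (by linarith), sign_neg (by linarith)]
      push_cast; simp; ring

/-- The free wave evolution, determined by its action on `mono m`. -/
theorem exists_dilation : ∃ (S : ℝ≥0 → Energy →L[ℂ] Energy) (C : ℝ), 0 < C ∧
    (∀ t, ‖S t‖ ≤ C * Real.exp (t / 2)) ∧
    ∀ t m, S t (mono m) = (Real.exp (-(m * t)) : ℂ) • mono m := by
  obtain ⟨E, Q, -, hE, hQ⟩ := exists_fold_unfold
  -- `T` is the dilation `w(y) ↦ w(e^{-t} y)`; the Jacobian contributes `√(e^t) = e^{t/2}` to its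
  -- norm bound.
  have key : ∀ t : ℝ≥0, ∃ T : Lp ℂ 2 doubleMeasure →L[ℂ] Lp ℂ 2 doubleMeasure,
      ‖T‖ ≤ Real.exp (t / 2) ∧
      ∀ m, T (memLp_pow m).toLp = (Real.exp (-(m * t)) : ℂ) • (memLp_pow m).toLp := by
    intro t
    have hmaps : ∀ x ∈ Ioo (0 : ℝ) 2, Real.exp (-t) * x + 0 ∈ Ioo (0 : ℝ) 2 := by
      rintro x ⟨h1, h2⟩
      have : Real.exp (-t) ≤ 1 := Real.exp_le_one_iff.2 (by simp)
      have h0 := Real.exp_pos (-t)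
      constructor <;> nlinarith
    obtain ⟨T, hT, hTn⟩ := exists_weightedComp (m := fun _ => 1) (B := 1)
      (by fun_prop) measurable_const zero_le_one (by simp)
      (map_affine_restrict_le (Real.exp_pos (-(t : ℝ))).ne' hmaps)
    refine ⟨T, hTn.trans ?_, fun m => ?_⟩
    · rw [one_mul, coe_nnnorm, ← Real.exp_neg, Real.norm_of_nonneg (Real.exp_pos _).le, neg_neg,
        ← Real.exp_half]
    · apply Lp.ext
      filter_upwards [hT (memLp_pow m).toLp, (memLp_pow m).coeFn_toLp,
        Lp.coeFn_smul (Real.exp (-(m * t)) : ℂ) (memLp_pow m).toLp,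
        ae_affine (Real.exp_pos (-(t : ℝ))).ne' hmaps
          (memLp_pow m).coeFn_toLp] with y h1 h2 h3 h4
      rw [h1, h3, Pi.smul_apply, h2, h4, smul_eq_mul, one_mul, add_zero, Complex.ofReal_mul,
        mul_pow, ← Complex.ofReal_pow, ← Real.exp_nat_mul, mul_neg]
  choose T hT1 hT2 using key
  -- The `+ 1` only makes the constant strictly positive.
  refine ⟨fun t => (Q.comp (T t)).comp E, ‖Q‖ * ‖E‖ + 1, by positivity, fun t => ?_,
    fun t m => ?_⟩
  · have h1 := ContinuousLinearMap.opNorm_comp_le (Q.comp (T t)) E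
    have h2 := ContinuousLinearMap.opNorm_comp_le Q (T t)
    have h3 := hT1 t
    have h0 := Real.exp_pos (t / 2 : ℝ)
    calc _ ≤ ‖Q‖ * Real.exp (t / 2) * ‖E‖ := by
          refine h1.trans ?_
          gcongr
          refine h2.trans ?_
          gcongr
      _ ≤ _ := by nlinarith
  · simp [hE, hT2, hQ]

/-! ### Density of the polynomials -/

theorem exists_complex_polynomial_near {f : ℝ → ℂ} (hf : Continuous f) {ε : ℝ} (hε : 0 < ε) :
    ∃ p : Polynomial ℂ, ∀ x ∈ Icc (0 : ℝ) 2, ‖p.eval (x : ℂ) - f x‖ ≤ ε := by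
  obtain ⟨p, hp⟩ := exists_polynomial_near_of_continuousOn 0 2 (fun x => (f x).re)
    (Complex.continuous_re.comp hf).continuousOn (ε / 2) (by positivity)
  obtain ⟨q, hq⟩ := exists_polynomial_near_of_continuousOn 0 2 (fun x => (f x).im)
    (Complex.continuous_im.comp hf).continuousOn (ε / 2) (by positivity)
  refine ⟨p.map Complex.ofRealHom + Polynomial.C Complex.I * q.map Complex.ofRealHom,
    fun x hx => ?_⟩
  have e : ∀ r : Polynomial ℝ, (r.map Complex.ofRealHom).eval (x : ℂ) = (r.eval x : ℝ) :=
    fun r => Polynomial.eval_map_apply (f := Complex.ofRealHom) x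
  rw [Polynomial.eval_add, Polynomial.eval_mul, Polynomial.eval_C, e, e]
  have : ((p.eval x : ℝ) : ℂ) + Complex.I * (q.eval x : ℝ) - f x =
      ((p.eval x - (f x).re : ℝ) : ℂ) + Complex.I * ((q.eval x - (f x).im : ℝ) : ℂ) := by
    conv_lhs => rw [← Complex.re_add_im (f x)]
    push_cast; ring
  rw [this]
  refine (norm_add_le _ _).trans ?_
  rw [norm_mul, Complex.norm_I, one_mul, Complex.norm_real, Complex.norm_real]
  have h1 := hp x hx
  have h2 := hq x hx
  rw [Real.norm_eq_abs, Real.norm_eq_abs]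
  linarith

theorem span_pow_dense :
    (Submodule.span ℂ (range fun m => (memLp_pow m).toLp)).topologicalClosure = ⊤ := by
  rw [← Submodule.dense_iff_topologicalClosure_eq_top]
  have hpoly : ∀ p : Polynomial ℂ, ∃ w ∈ Submodule.span ℂ (range fun m => (memLp_pow m).toLp),
      w =ᵐ[doubleMeasure] fun y => p.eval (y : ℂ) := by
    intro p
    induction p using Polynomial.induction_on' with
    | add p q hp hq =>
      obtain ⟨v, hv, hv'⟩ := hp
      obtain ⟨w, hw, hw'⟩ := hq
      refine ⟨v + w, add_mem hv hw, ?_⟩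
      filter_upwards [hv', hw', Lp.coeFn_add v w] with y h1 h2 h3
      rw [h3, Pi.add_apply, h1, h2, Polynomial.eval_add]
    | monomial n a =>
      refine ⟨a • (memLp_pow n).toLp, Submodule.smul_mem _ _ (Submodule.subset_span ⟨n, rfl⟩), ?_⟩
      filter_upwards [(memLp_pow n).coeFn_toLp, Lp.coeFn_smul a (memLp_pow n).toLp] with y h1 h2
      rw [h2, Pi.smul_apply, h1, Polynomial.eval_monomial, smul_eq_mul]
  have hd := BoundedContinuousFunction.toLp_denseRange (p := 2) ℂ doubleMeasure ℂ (by norm_num)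
  refine dense_iff_closure_eq.2 (eq_univ_of_univ_subset ?_)
  rw [← hd.closure_range]
  refine closure_minimal ?_ isClosed_closure
  rintro _ ⟨f, rfl⟩
  refine Metric.mem_closure_iff.2 fun ε hε => ?_
  -- The interval has mass `2`, so a sup bound costs a factor `√2`; estimating it by `2` leaves `ε /
  -- 2 < ε`.
  obtain ⟨p, hp⟩ := exists_complex_polynomial_near f.continuous (ε := ε / 4) (by positivity)
  obtain ⟨w, hw, hw'⟩ := hpoly p
  refine ⟨w, hw, ?_⟩
  rw [dist_eq_norm]
  have hb : ∀ᵐ y ∂doubleMeasure, ‖(BoundedContinuousFunction.toLp 2 doubleMeasure ℂ f - w) y‖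
      ≤ ε / 4 := by
    filter_upwards [ae_restrict_mem measurableSet_Ioo, hw',
      BoundedContinuousFunction.coeFn_toLp (p := 2) doubleMeasure ℂ f,
      Lp.coeFn_sub (BoundedContinuousFunction.toLp 2 doubleMeasure ℂ f) w] with y h1 h2 h3 h4
    rw [h4, Pi.sub_apply, h2, h3, norm_sub_rev]
    exact hp y (Ioo_subset_Icc_self h1)
  have := Lp.norm_le_of_ae_bound (by positivity) hb
  refine this.trans_lt ?_
  have h2 : (doubleMeasure univ : ENNReal) = 2 := by simp
  have h3 : ((measureUnivNNReal doubleMeasure : ℝ≥0) ^ ((2 : ENNReal).toReal)⁻¹ : ℝ) ≤ 2 := by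
    have : (measureUnivNNReal doubleMeasure : ℝ≥0) = 2 := by
      rw [measureUnivNNReal, h2]; rfl
    rw [this]
    calc ((2 : ℝ≥0) : ℝ) ^ ((2 : ENNReal).toReal)⁻¹ ≤ (2 : ℝ) ^ (1 : ℝ) :=
          Real.rpow_le_rpow_of_exponent_le (by norm_num) (by norm_num)
      _ = 2 := by norm_num
  nlinarith

/-- A closed subspace of the energy space containing all `mono m` is everything. -/
theorem mem_of_mono_mem (K : Submodule ℂ Energy) (hK : IsClosed (K : Set Energy))
    (h : ∀ m, mono m ∈ K) (u : Energy) : u ∈ K := by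
  obtain ⟨E, Q, hQE, -, hQ⟩ := exists_fold_unfold
  rw [← hQE u]
  have hle : (Submodule.span ℂ (range fun m => (memLp_pow m).toLp)).topologicalClosure ≤
      K.comap (Q : Lp ℂ 2 doubleMeasure →ₗ[ℂ] Energy) := by
    refine Submodule.topologicalClosure_minimal _ ?_ (hK.preimage Q.continuous)
    rw [Submodule.span_le]
    rintro _ ⟨m, rfl⟩
    change Q _ ∈ K
    rw [hQ]; exact h m
  rw [span_pow_dense] at hle
  exact hle (Submodule.mem_top (x := E u))

/-- Bounded operators agreeing on all `mono m` are equal. -/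
theorem ext_mono {F : Type*} [NormedAddCommGroup F] [NormedSpace ℂ F] {A B : Energy →L[ℂ] F}
    (h : ∀ m, A (mono m) = B (mono m)) : A = B := by
  ext1 u
  exact mem_of_mono_mem (LinearMap.eqLocus (A : Energy →ₗ[ℂ] F) B)
    (isClosed_eq A.continuous B.continuous) h u

/-! ### Strongly continuous semigroups -/

section Semigroup

variable {X : Type*} [NormedAddCommGroup X] [NormedSpace ℂ X]

/-- A strongly continuous one-parameter semigroup of bounded operators. -/
structure IsC0Semigroup (S : ℝ≥0 → X →L[ℂ] X) : Prop where
  zero : S 0 = ContinuousLinearMap.id ℂ X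
  add : ∀ s t, S (s + t) = (S s).comp (S t)
  continuous : ∀ x, Continuous fun t => S t x

/-- The pair `(x, y)` belongs to the graph of the infinitesimal generator of `S`. -/
def GeneratesAt (S : ℝ≥0 → X →L[ℂ] X) (x y : X) : Prop :=
  Tendsto (fun h : ℝ≥0 => (((h : ℝ)⁻¹ : ℝ) : ℂ) • (S h x - x)) (𝓝[>] 0) (𝓝 y)

variable {S T : ℝ≥0 → X →L[ℂ] X} {x y x' y' : X}

theorem GeneratesAt.map (hS : IsC0Semigroup S) (h : GeneratesAt S x y) (s : ℝ≥0) :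
    GeneratesAt S (S s x) (S s y) := by
  refine (((S s).continuous.tendsto y).comp h).congr fun r => ?_
  have : S r (S s x) = S s (S r x) := by
    rw [← ContinuousLinearMap.comp_apply, ← ContinuousLinearMap.comp_apply, ← hS.add, ← hS.add,
      add_comm]
  simp [this]

theorem GeneratesAt.sub (h : GeneratesAt S x y) (h' : GeneratesAt S x' y') :
    GeneratesAt S (x - x') (y - y') := by
  refine (Tendsto.sub h h').congr fun r => ?_
  simp only [map_sub, ← smul_sub]
  congr 1; abel

theorem GeneratesAt.add (h : GeneratesAt S x y) (h' : GeneratesAt S x' y') :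
    GeneratesAt S (x + x') (y + y') := by
  refine (Tendsto.add h h').congr fun r => ?_
  simp only [map_add, ← smul_add]
  congr 1; abel

theorem GeneratesAt.smul (h : GeneratesAt S x y) (c : ℂ) :
    GeneratesAt S (c • x) (c • y) := by
  refine (Tendsto.const_smul h c).congr fun r => ?_
  rw [map_smul, ← smul_sub, smul_comm]

theorem tendsto_toNNReal_sub (t : ℝ) :
    Tendsto (fun s : ℝ => (s - t).toNNReal) (𝓝[>] t) (𝓝[>] 0) := by
  refine tendsto_nhdsWithin_iff.2 ⟨?_, ?_⟩
  · have : Tendsto (fun s : ℝ => (s - t).toNNReal) (𝓝 t) (𝓝 (t - t).toNNReal) :=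
      (continuous_real_toNNReal.comp (continuous_id.sub continuous_const)).tendsto t
    rw [sub_self, Real.toNNReal_zero] at this
    exact this.mono_left nhdsWithin_le_nhds
  · filter_upwards [self_mem_nhdsWithin] with s hs
    exact Real.toNNReal_pos.2 (sub_pos.2 hs)

theorem GeneratesAt.tendsto_slope (h : GeneratesAt S x y) (t : ℝ) :
    Tendsto (fun s : ℝ => (s - t)⁻¹ • (S (s - t).toNNReal x - x)) (𝓝[>] t) (𝓝 y) := by
  refine (h.comp (tendsto_toNNReal_sub t)).congr' ?_
  filter_upwards [self_mem_nhdsWithin] with s hs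
  simp only [Function.comp]
  rw [Real.coe_toNNReal _ (sub_pos.2 hs).le, Complex.coe_smul]

/-- `S_s x - S_t x = S_t (S_{s-t} x - x)` for `s > t` gives the right derivative directly from the
generator. One-sided derivatives suffice for the mean value inequalities below. -/
theorem GeneratesAt.hasDerivWithinAt (hS : IsC0Semigroup S) (h : GeneratesAt S x y) {t : ℝ}
    (ht : 0 ≤ t) :
    HasDerivWithinAt (fun s : ℝ => S s.toNNReal x) (S t.toNNReal y) (Ici t) t := by
  rw [← hasDerivWithinAt_Ioi_iff_Ici, hasDerivWithinAt_iff_tendsto_slope' self_notMem_Ioi]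
  refine (((S t.toNNReal).continuous.tendsto y).comp (h.tendsto_slope t)).congr' ?_
  filter_upwards [self_mem_nhdsWithin] with s hs
  have hs' : (0 : ℝ) ≤ s - t := (sub_pos.2 hs).le
  have : s.toNNReal = t.toNNReal + (s - t).toNNReal := by
    rw [← Real.toNNReal_add ht hs', add_sub_cancel]
  rw [slope_def_module, this, hS.add]
  simp only [Function.comp, ContinuousLinearMap.comp_apply, ← map_sub]
  rw [← Complex.coe_smul, ← Complex.coe_smul, map_smul]

theorem IsC0Semigroup.continuous_toNNReal (hS : IsC0Semigroup S) (x : X) :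
    Continuous fun s : ℝ => S s.toNNReal x :=
  (hS.continuous x).comp continuous_real_toNNReal

/-- Uniform boundedness principle: each orbit is continuous, hence bounded on a compact time
interval. -/
theorem IsC0Semigroup.exists_bound [CompleteSpace X] (hS : IsC0Semigroup S) (t : ℝ≥0) :
    ∃ K, 0 < K ∧ ∀ s ≤ t, ‖S s‖ ≤ K := by
  obtain ⟨K, hK⟩ := banach_steinhaus (g := fun s : Set.Icc 0 t => S s) (fun x => by
    obtain ⟨C, hC⟩ := isCompact_Icc.exists_bound_of_continuousOn
      (hS.continuous x).continuousOn (s := Icc 0 t)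
    exact ⟨C, fun s => hC s s.2⟩)
  exact ⟨max K 1, by positivity, fun s hs => (hK ⟨s, zero_le, hs⟩).trans (le_max_left ..)⟩

/-- If a subset of the generator's graph accumulates at `(x, y)`, then `(x, y)` is in the graph. -/
theorem isClosed_generatesAt [CompleteSpace X] (hS : IsC0Semigroup S) :
    IsClosed {p : X × X | GeneratesAt S p.1 p.2} := by
  refine isClosed_of_closure_subset ?_
  rintro ⟨x, y⟩ hxy
  obtain ⟨K, hK0, hK⟩ := hS.exists_bound 1
  -- On the graph, the mean value inequality for `S_s x' - s y` bounds the increment, with error `K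
  -- ‖y' - y‖` from replacing `y` by `y'`. The bound is a closed condition in `(x', y')`, so it
  -- passes to the limit point, where the error vanishes.
  have main : ∀ ε > 0, ∀ h : ℝ≥0, h ≤ 1 → (∀ s ≤ h, ‖S s y - y‖ ≤ ε) →
      ‖S h x - x - (h : ℝ) • y‖ ≤ ε * h := by
    intro ε hε h h1 hs
    have hclosed : IsClosed {p : X × X |
        ‖S h p.1 - p.1 - (h : ℝ) • y‖ ≤ (ε + K * ‖p.2 - y‖) * h} :=
      isClosed_le (by fun_prop) (by fun_prop)
    have hsub : {p : X × X | GeneratesAt S p.1 p.2} ⊆ {p : X × X |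
        ‖S h p.1 - p.1 - (h : ℝ) • y‖ ≤ (ε + K * ‖p.2 - y‖) * h} := by
      rintro ⟨x', y'⟩ hg
      have hg : GeneratesAt S x' y' := hg
      have := norm_image_sub_le_of_norm_deriv_right_le_segment (a := 0) (b := h)
        (f := fun s : ℝ => S s.toNNReal x' - s • y) (f' := fun s => S s.toNNReal y' - y)
        (C := ε + K * ‖y' - y‖)
        ((hS.continuous_toNNReal x').sub (by fun_prop)).continuousOn
        (fun s hs => (hg.hasDerivWithinAt hS hs.1).sub
          (by simpa using ((hasDerivAt_id s).smul_const y).hasDerivWithinAt))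
        (fun s hsm => by
          have hsh : s.toNNReal ≤ h := Real.toNNReal_le_iff_le_coe.2 hsm.2.le
          have e : S s.toNNReal y' - y = (S s.toNNReal y - y) + S s.toNNReal (y' - y) := by
            rw [map_sub]; abel
          rw [e]
          refine (norm_add_le _ _).trans (add_le_add (hs _ hsh) ?_)
          exact ((S _).le_opNorm _).trans (by gcongr; exact hK _ (hsh.trans h1)))
        h (right_mem_Icc.2 h.2)
      simp only [Real.toNNReal_coe, Real.toNNReal_zero, hS.zero, zero_smul, sub_zero,
        ContinuousLinearMap.id_apply] at this
      have e : S h x' - x' - (h : ℝ) • y = S h x' - (h : ℝ) • y - x' := by abel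
      change ‖S h x' - x' - (h : ℝ) • y‖ ≤ _
      rwa [e]
    have := closure_minimal hsub hclosed hxy
    simpa using this
  refine Metric.tendsto_nhds.2 fun ε hε => ?_
  have hc : Tendsto (fun s => S s y) (𝓝 0) (𝓝 y) := by
    have := (hS.continuous y).tendsto 0
    simpa [hS.zero] using this
  obtain ⟨δ, hδ, hδ'⟩ := Metric.eventually_nhds_iff.1
    (Metric.tendsto_nhds.1 hc (ε / 2) (by positivity))
  have hδ₀ : 0 < min 1 δ.toNNReal := lt_min one_pos (Real.toNNReal_pos.2 hδ)
  have hev : ∀ᶠ h : ℝ≥0 in 𝓝[>] 0, h < min 1 δ.toNNReal :=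
    nhdsWithin_le_nhds (Iio_mem_nhds hδ₀)
  filter_upwards [hev, self_mem_nhdsWithin] with h hh hpos
  have hpos' : (0 : ℝ) < h := hpos
  have := main (ε / 2) (by positivity) h (hh.le.trans (min_le_left ..)) (fun s hs => by
    rw [← dist_eq_norm]
    refine (hδ' ?_).le
    have : (s : ℝ) < δ :=
      Real.lt_toNNReal_iff_coe_lt.1 ((hs.trans_lt hh).trans_le (min_le_right ..))
    simpa [NNReal.dist_eq] using this)
  rw [Complex.coe_smul, dist_eq_norm]
  have e : (h : ℝ)⁻¹ • (S h x - x) - y = (h : ℝ)⁻¹ • (S h x - x - (h : ℝ) • y) := by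
    rw [smul_sub _ _ ((h : ℝ) • y), smul_smul, inv_mul_cancel₀ hpos'.ne', one_smul]
  rw [e, norm_smul, norm_inv, Real.norm_of_nonneg hpos'.le, inv_mul_lt_iff₀ hpos']
  nlinarith

/-- Two strongly continuous semigroups with a common, densely defined generator agree. -/
theorem IsC0Semigroup.eq_of_generatesAt [CompleteSpace X] (hS : IsC0Semigroup S)
    (hT : IsC0Semigroup T) (hST : ∀ x y, GeneratesAt S x y → GeneratesAt T x y)
    (hd : Dense {x | ∃ y, GeneratesAt S x y}) : S = T := by
  funext t
  have hon : ∀ x ∈ {x | ∃ y, GeneratesAt S x y}, S t x = T t x := by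
    rintro x ⟨y, hxy⟩
    obtain ⟨K, hK0, hK⟩ := hT.exists_bound t
    have hbound : ∀ s : ℝ, 0 ≤ s → ‖T ((t : ℝ) - s).toNNReal‖ ≤ K := fun s hs =>
      hK _ (Real.toNNReal_le_iff_le_coe.2 (by linarith))
    -- Strong continuity gives continuity in one slot at a time; the uniform bound `K` controls the
    -- change of the vector inside `T`.
    have hcont : ContinuousOn (fun s : ℝ => T ((t : ℝ) - s).toNNReal (S s.toNNReal x))
        (Icc 0 t) := by
      intro s₀ hs₀
      have h1 : Tendsto (fun s : ℝ => T ((t : ℝ) - s).toNNReal (S s₀.toNNReal x))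
          (𝓝[Icc 0 (t : ℝ)] s₀) (𝓝 (T ((t : ℝ) - s₀).toNNReal (S s₀.toNNReal x))) :=
        (((hT.continuous_toNNReal _).comp (continuous_const.sub continuous_id)).tendsto
          s₀).mono_left nhdsWithin_le_nhds
      have h2 : Tendsto (fun s : ℝ =>
          T ((t : ℝ) - s).toNNReal (S s.toNNReal x - S s₀.toNNReal x))
          (𝓝[Icc 0 (t : ℝ)] s₀) (𝓝 0) := by
        refine squeeze_zero_norm' (a := fun s : ℝ => K * ‖S s.toNNReal x - S s₀.toNNReal x‖) ?_ ?_
        · filter_upwards [self_mem_nhdsWithin] with s hs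
          exact ((T _).le_opNorm _).trans (by gcongr; exact hbound s hs.1)
        · have hc : Continuous fun s : ℝ => K * ‖S s.toNNReal x - S s₀.toNNReal x‖ :=
            continuous_const.mul ((hS.continuous_toNNReal x).sub continuous_const).norm
          have := hc.tendsto s₀
          simp only [sub_self, norm_zero, mul_zero] at this
          exact this.mono_left nhdsWithin_le_nhds
      have := h2.add h1
      rw [zero_add] at this
      refine this.congr fun s => ?_
      rw [← map_add, sub_add_cancel]
    -- The difference quotient is `T_{t-r}` applied to the difference of the quotients of `S` and
    -- `T` at `S_s x`. Both tend to the same generator value, so `T_{t-s} S_s x` is constant in `s`.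
    have hderiv : ∀ s ∈ Ico (0 : ℝ) t,
        HasDerivWithinAt (fun s : ℝ => T ((t : ℝ) - s).toNNReal (S s.toNNReal x)) 0 (Ici s) s := by
      intro s hs
      rw [← hasDerivWithinAt_Ioi_iff_Ici, hasDerivWithinAt_iff_tendsto_slope' self_notMem_Ioi]
      have hz := hxy.map hS s.toNNReal
      have hlim := ((hz.tendsto_slope s).sub ((hST _ _ hz).tendsto_slope s)).norm.const_mul K
      rw [sub_self, norm_zero, mul_zero] at hlim
      refine squeeze_zero_norm' ?_ hlim
      filter_upwards [self_mem_nhdsWithin, nhdsWithin_le_nhds (Iio_mem_nhds hs.2)] with r hr hrt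
      have hr0 : (0 : ℝ) ≤ r - s := (sub_pos.2 hr).le
      have hrt' : (0 : ℝ) ≤ t - r := (sub_pos.2 hrt).le
      have e1 : r.toNNReal = (r - s).toNNReal + s.toNNReal := by
        rw [← Real.toNNReal_add hr0 hs.1, sub_add_cancel]
      have e2 : ((t : ℝ) - s).toNNReal = ((t : ℝ) - r).toNNReal + (r - s).toNNReal := by
        rw [← Real.toNNReal_add hrt' hr0, sub_add_sub_cancel]
      rw [slope_def_module, e1, e2, hS.add, hT.add]
      simp only [ContinuousLinearMap.comp_apply, ← map_sub]
      rw [← Complex.coe_smul, ← map_smul]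
      refine ((T _).le_opNorm _).trans ?_
      have e3 : ∀ a b c : X, (r - s)⁻¹ • (a - c) - (r - s)⁻¹ • (b - c) =
          (((r - s)⁻¹ : ℝ) : ℂ) • (a - b) := fun a b c => by
        rw [Complex.coe_smul, ← smul_sub, sub_sub_sub_cancel_right]
      rw [e3]
      gcongr
      exact hbound r (hs.1.trans hr.le)
    have := constant_of_has_deriv_right_zero hcont hderiv t (right_mem_Icc.2 t.2)
    simpa [hS.zero, hT.zero] using this
  have := Continuous.ext_on hd (S t).continuous (T t).continuous hon
  exact ContinuousLinearMap.ext fun x => congrFun this x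

/-- The resolvent estimate at `1`, which exceeds the growth rate `1/2`. The derivative of `e^{-s}
S_s x` is `e^{-s} S_s (y - x)`, of norm at most `C e^{-s/2} ‖y - x‖`; integrating over `[0, ∞)`
gives the factor `2C`, while `e^{-t} S_t x → 0`. -/
theorem GeneratesAt.norm_le (hS : IsC0Semigroup S) {C : ℝ}
    (hC : ∀ t : ℝ≥0, ‖S t‖ ≤ C * Real.exp (t / 2)) (h : GeneratesAt S x y) :
    ‖x‖ ≤ 2 * C * ‖x - y‖ := by
  have hC0 : 0 ≤ C := by
    have := (norm_nonneg _).trans (hC 0)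
    simpa using this
  have hexp : ∀ s : ℝ, HasDerivAt (fun s : ℝ => Real.exp (-s)) (-Real.exp (-s)) s := fun s => by
    simpa using (hasDerivAt_neg s).exp
  have hSn : ∀ (s : ℝ) (z : X), 0 ≤ s →
      ‖Real.exp (-s) • S s.toNNReal z‖ ≤ C * Real.exp (-(s / 2)) * ‖z‖ := by
    intro s z hs
    rw [norm_smul, Real.norm_of_nonneg (Real.exp_pos _).le]
    have h1 := ((S s.toNNReal).le_opNorm z).trans
      (mul_le_mul_of_nonneg_right (hC _) (norm_nonneg z))
    rw [Real.coe_toNNReal _ hs] at h1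
    refine (mul_le_mul_of_nonneg_left h1 (Real.exp_pos (-s)).le).trans (le_of_eq ?_)
    have : Real.exp (-(s / 2)) = Real.exp (-s) * Real.exp (s / 2) := by
      rw [← Real.exp_add]; ring_nf
    rw [this]; ring
  have main : ∀ t : ℝ, 0 ≤ t →
      ‖Real.exp (-t) • S t.toNNReal x - x‖ ≤ 2 * C * ‖x - y‖ := by
    intro t ht
    have hB : ∀ s : ℝ, HasDerivAt (fun s : ℝ => 2 * C * ‖x - y‖ * (1 - Real.exp (-(s / 2))))
        (C * Real.exp (-(s / 2)) * ‖y - x‖) s := fun s => by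
      have h1 : HasDerivAt (fun s : ℝ => Real.exp (-(s / 2))) (Real.exp (-(s / 2)) * (-(1 / 2))) s :=
        (((hasDerivAt_id s).div_const 2).neg).exp
      refine ((h1.const_sub 1).const_mul (2 * C * ‖x - y‖)).congr_deriv ?_
      rw [norm_sub_rev]; ring
    have := image_norm_le_of_norm_deriv_right_le_deriv_boundary (a := 0) (b := t)
      (f := fun s : ℝ => Real.exp (-s) • S s.toNNReal x - x)
      (f' := fun s : ℝ => Real.exp (-s) • S s.toNNReal (y - x))
      (B := fun s => 2 * C * ‖x - y‖ * (1 - Real.exp (-(s / 2))))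
      (B' := fun s => C * Real.exp (-(s / 2)) * ‖y - x‖)
      (((by fun_prop : Continuous fun s : ℝ => Real.exp (-s)).smul
        (hS.continuous_toNNReal x)).sub continuous_const).continuousOn
      (fun s hs => by
        refine HasDerivWithinAt.congr_deriv
          (((hexp s).hasDerivWithinAt.smul (h.hasDerivWithinAt hS hs.1)).sub_const x) ?_
        rw [map_sub, smul_sub, neg_smul, sub_eq_add_neg])
      (by simp [hS.zero]) hB
      (fun s hs => hSn s (y - x) hs.1) (right_mem_Icc.2 ht)
    refine this.trans ?_
    have h0 := Real.exp_pos (-(t / 2))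
    have h1 : 0 ≤ 2 * C * ‖x - y‖ := by positivity
    nlinarith
  have hlim : Tendsto (fun t : ℝ => 2 * C * ‖x - y‖ + C * Real.exp (-(t / 2)) * ‖x‖) atTop
      (𝓝 (2 * C * ‖x - y‖ + C * 0 * ‖x‖)) := by
    refine tendsto_const_nhds.add (Tendsto.mul_const _ (Tendsto.const_mul _ ?_))
    exact Real.tendsto_exp_neg_atTop_nhds_zero.comp (tendsto_id.atTop_div_const (by norm_num))
  rw [mul_zero, zero_mul, add_zero] at hlim
  refine ge_of_tendsto hlim ?_
  filter_upwards [eventually_ge_atTop 0] with t ht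
  have e : x = -(Real.exp (-t) • S t.toNNReal x - x) + Real.exp (-t) • S t.toNNReal x := by abel
  calc ‖x‖ = ‖-(Real.exp (-t) • S t.toNNReal x - x) + Real.exp (-t) • S t.toNNReal x‖ := by
        rw [← e]
    _ ≤ _ := (norm_add_le _ _).trans (add_le_add ((norm_neg _).trans_le (main t ht)) (hSn t x ht))

end Semigroup

/-! ### Primitives -/

instance : IsProbabilityMeasure unitMeasure := ⟨by simp⟩

theorem L2.integrable (f : L2) : Integrable f unitMeasure := (Lp.memLp f).integrable (by norm_num)

theorem integral_norm_le (f : L2) : ∫ s in Ioo (0 : ℝ) 1, ‖f s‖ ≤ ‖f‖ := by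
  have h1 := eLpNorm_le_eLpNorm_of_exponent_le (p := 1) (q := 2) (μ := unitMeasure) (by norm_num)
    (Lp.aestronglyMeasurable f)
  rw [eLpNorm_one_eq_lintegral_enorm, ← ofReal_integral_norm_eq_lintegral_enorm f.integrable] at h1
  have := ENNReal.toReal_mono (Lp.eLpNorm_lt_top f).ne h1
  rwa [ENNReal.toReal_ofReal (integral_nonneg fun _ => norm_nonneg _), ← Lp.norm_def] at this

/-- On a probability space a sup bound by `‖f‖` is also an `L²` bound. This serves the primitive and
the mean. -/
theorem exists_op_of_bounded (F : L2 → ℝ → ℂ)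
    (hadd : ∀ f g, ∀ ρ ∈ Ioo (0 : ℝ) 1, F (f + g) ρ = F f ρ + F g ρ)
    (hsmul : ∀ (a : ℂ) (f), ∀ ρ ∈ Ioo (0 : ℝ) 1, F (a • f) ρ = a * F f ρ)
    (hm : ∀ f, AEStronglyMeasurable (F f) unitMeasure)
    (hb : ∀ f, ∀ ρ ∈ Ioo (0 : ℝ) 1, ‖F f ρ‖ ≤ ‖f‖) :
    ∃ T : L2 →L[ℂ] L2, ∀ f, T f =ᵐ[unitMeasure] F f := by
  have hmemI : ∀ᵐ ρ ∂unitMeasure, ρ ∈ Ioo (0 : ℝ) 1 := ae_restrict_mem measurableSet_Ioo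
  have hmem : ∀ f, MemLp (F f) 2 unitMeasure := fun f =>
    MemLp.of_bound (hm f) ‖f‖ (hmemI.mono fun ρ hρ => hb f ρ hρ)
  let T : L2 →ₗ[ℂ] L2 :=
    { toFun := fun f => (hmem f).toLp _
      map_add' := by
        intro f g
        apply Lp.ext
        filter_upwards [(hmem (f + g)).coeFn_toLp, (hmem f).coeFn_toLp, (hmem g).coeFn_toLp,
          Lp.coeFn_add ((hmem f).toLp _) ((hmem g).toLp _), hmemI] with x h1 h2 h3 h4 h5
        rw [h1, h4, Pi.add_apply, h2, h3, hadd f g x h5]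
      map_smul' := by
        intro a f
        apply Lp.ext
        filter_upwards [(hmem (a • f)).coeFn_toLp, (hmem f).coeFn_toLp,
          Lp.coeFn_smul a ((hmem f).toLp _), hmemI] with x h1 h2 h4 h5
        simp only [RingHom.id_apply]
        rw [h1, h4, Pi.smul_apply, h2, hsmul a f x h5, smul_eq_mul] }
  have hT : ∀ f, ‖T f‖ ≤ 1 * ‖f‖ := by
    intro f
    have : ∀ᵐ ρ ∂unitMeasure, ‖T f ρ‖ ≤ ‖f‖ := by
      filter_upwards [(hmem f).coeFn_toLp, hmemI] with ρ h1 h2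
      change ‖(hmem f).toLp _ ρ‖ ≤ _
      rw [h1]; exact hb f ρ h2
    simpa [measureUnivNNReal] using Lp.norm_le_of_ae_bound (norm_nonneg f) this
  exact ⟨T.mkContinuous _ hT, fun f => (hmem f).coeFn_toLp⟩

theorem L2.integrableOn_Icc (f : L2) : IntegrableOn f (Icc (0 : ℝ) 1) volume :=
  (integrableOn_Icc_iff_integrableOn_Ioo).2 f.integrable

theorem L2.intervalIntegrable (f : L2) {a b : ℝ} (ha : a ∈ Icc (0 : ℝ) 1)
    (hb : b ∈ Icc (0 : ℝ) 1) : IntervalIntegrable f volume a b := by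
  have h' : IntervalIntegrable f volume 0 1 :=
    (intervalIntegrable_iff_integrableOn_Icc_of_le zero_le_one).2
      f.integrableOn_Icc
  exact h'.mono_set (by rw [uIcc_of_le zero_le_one]; exact uIcc_subset_Icc ha hb)

theorem zero_mem_unit : (0 : ℝ) ∈ Icc (0 : ℝ) 1 := ⟨le_rfl, zero_le_one⟩

theorem one_mem_unit : (1 : ℝ) ∈ Icc (0 : ℝ) 1 := ⟨zero_le_one, le_rfl⟩

theorem integral_congr_unit {f g : ℝ → ℂ} (h : f =ᵐ[unitMeasure] g) {ρ : ℝ}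
    (hρ : ρ ∈ Icc (0 : ℝ) 1) : ∫ s in (0 : ℝ)..ρ, f s = ∫ s in (0 : ℝ)..ρ, g s := by
  rw [intervalIntegral.integral_of_le hρ.1, intervalIntegral.integral_of_le hρ.1,
    integral_Ioc_eq_integral_Ioo, integral_Ioc_eq_integral_Ioo]
  exact integral_congr_ae (ae_restrict_of_ae_restrict_of_subset (Ioo_subset_Ioo_right hρ.2) h)

theorem L2.continuousOn_primitive (f : L2) :
    ContinuousOn (fun ρ => ∫ s in (0 : ℝ)..ρ, f s) (Icc 0 1) := by
  have := intervalIntegral.continuousOn_primitive_interval (f := f) (a := 0) (b := 1)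
    (μ := volume) (by rw [uIcc_of_le zero_le_one]; exact f.integrableOn_Icc)
  rwa [uIcc_of_le zero_le_one] at this

theorem norm_primitive_le (f : L2) {ρ : ℝ} (hρ : ρ ∈ Icc (0 : ℝ) 1) :
    ‖∫ s in (0 : ℝ)..ρ, f s‖ ≤ ‖f‖ := by
  refine (intervalIntegral.norm_integral_le_integral_norm hρ.1).trans
    (le_trans ?_ (integral_norm_le f))
  rw [intervalIntegral.integral_of_le hρ.1, integral_Ioc_eq_integral_Ioo]
  exact setIntegral_mono_set f.integrable.norm (Eventually.of_forall fun _ => norm_nonneg _)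
    (Ioo_subset_Ioo_right hρ.2).eventuallyLE

theorem primitive_add (f g : L2) {ρ : ℝ} (hρ : ρ ∈ Icc (0 : ℝ) 1) :
    ∫ s in (0 : ℝ)..ρ, (f + g : L2) s = (∫ s in (0 : ℝ)..ρ, f s) + ∫ s in (0 : ℝ)..ρ, g s := by
  rw [integral_congr_unit (Lp.coeFn_add f g) hρ]
  exact intervalIntegral.integral_add (f.intervalIntegrable zero_mem_unit hρ)
    (g.intervalIntegrable zero_mem_unit hρ)

theorem primitive_smul (a : ℂ) (f : L2) {ρ : ℝ} (hρ : ρ ∈ Icc (0 : ℝ) 1) :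
    ∫ s in (0 : ℝ)..ρ, (a • f : L2) s = a * ∫ s in (0 : ℝ)..ρ, f s := by
  rw [integral_congr_unit (Lp.coeFn_smul a f) hρ]
  exact intervalIntegral.integral_smul a _

theorem exists_primitive : ∃ J : L2 →L[ℂ] L2, ∀ f,
    J f =ᵐ[unitMeasure] fun ρ => ∫ s in (0 : ℝ)..ρ, f s :=
  exists_op_of_bounded (fun f ρ => ∫ s in (0 : ℝ)..ρ, f s)
    (fun f g _ hρ => primitive_add f g (Ioo_subset_Icc_self hρ))
    (fun a f _ hρ => primitive_smul a f (Ioo_subset_Icc_self hρ))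
    (fun f => (f.continuousOn_primitive.mono Ioo_subset_Icc_self).aestronglyMeasurable
      measurableSet_Ioo)
    (fun f _ hρ => norm_primitive_le f (Ioo_subset_Icc_self hρ))

theorem exists_mean : ∃ K : L2 →L[ℂ] L2, ∀ f,
    K f =ᵐ[unitMeasure] fun _ => ∫ s in (0 : ℝ)..1, f s :=
  exists_op_of_bounded (fun f _ => ∫ s in (0 : ℝ)..1, f s)
    (fun f g _ _ => primitive_add f g one_mem_unit)
    (fun a f _ _ => primitive_smul a f one_mem_unit)
    (fun _ => aestronglyMeasurable_const)
    (fun f _ _ => norm_primitive_le f one_mem_unit)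

/-- These are the odd and even parts about `y = 1` of `W(y) = ∫₀^y w`, where `w` is the profile of
`v`. The constant in the second component is `W(1) = ∫₀¹ (v₁ + v₂)`. -/
theorem exists_volterra : ∃ V : Energy →L[ℂ] Energy, ∀ v,
    (V v).fst =ᵐ[unitMeasure] (fun ρ => -∫ s in (0 : ℝ)..ρ, v.snd s) ∧
    (V v).snd =ᵐ[unitMeasure] (fun ρ => ((∫ s in (0 : ℝ)..1, v.fst s) +
      ∫ s in (0 : ℝ)..1, v.snd s) - ∫ s in (0 : ℝ)..ρ, v.fst s) := by
  obtain ⟨J, hJ⟩ := exists_primitive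
  obtain ⟨K, hK⟩ := exists_mean
  refine ⟨pairOp (-(J.comp sndOp)) (K.comp fstOp + K.comp sndOp - J.comp fstOp), fun v => ?_⟩
  constructor
  · filter_upwards [hJ v.snd, Lp.coeFn_neg (J v.snd)] with ρ h1 h2
    have : (pairOp (-(J.comp sndOp)) (K.comp fstOp + K.comp sndOp - J.comp fstOp) v).fst =
      -(J v.snd) := rfl
    rw [this, h2, Pi.neg_apply, h1]
  · filter_upwards [hJ v.fst, hK v.fst, hK v.snd, Lp.coeFn_add (K v.fst) (K v.snd),
      Lp.coeFn_sub (K v.fst + K v.snd) (J v.fst)] with ρ h1 h2 h3 h4 h5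
    have : (pairOp (-(J.comp sndOp)) (K.comp fstOp + K.comp sndOp - J.comp fstOp) v).snd =
      K v.fst + K v.snd - J v.fst := rfl
    rw [this, h5, Pi.sub_apply, h4, Pi.add_apply, h1, h2, h3]

/-- Integration from `0` of the half-wave profile. -/
def volterra : Energy →L[ℂ] Energy := exists_volterra.choose

theorem volterra_fst (v : Energy) :
    (volterra v).fst =ᵐ[unitMeasure] fun ρ => -∫ s in (0 : ℝ)..ρ, v.snd s :=
  (exists_volterra.choose_spec v).1

theorem volterra_snd (v : Energy) :
    (volterra v).snd =ᵐ[unitMeasure] fun ρ => ((∫ s in (0 : ℝ)..1, v.fst s) +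
      ∫ s in (0 : ℝ)..1, v.snd s) - ∫ s in (0 : ℝ)..ρ, v.fst s :=
  (exists_volterra.choose_spec v).2

/-- In `y w = (1 - ρ) w` the factor `ρ` is odd, so it exchanges the parities. -/
theorem exists_profileMul : ∃ M : Energy →L[ℂ] Energy, ∀ v,
    (M v).fst =ᵐ[unitMeasure] (fun ρ => v.fst ρ - ρ * v.snd ρ) ∧
    (M v).snd =ᵐ[unitMeasure] (fun ρ => v.snd ρ - ρ * v.fst ρ) := by
  obtain ⟨A, hA, -⟩ := exists_weightedComp (μ := unitMeasure) (ν := unitMeasure)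
    (φ := fun x => x) (m := fun x => (x : ℂ)) (B := 1) (c := 1) measurable_id
    Complex.measurable_ofReal zero_le_one (by
      filter_upwards [ae_restrict_mem measurableSet_Ioo] with x hx
      rw [Complex.norm_real, Real.norm_of_nonneg hx.1.le]; exact hx.2.le)
    (by rw [one_smul]; exact Measure.map_id.le)
  refine ⟨pairOp (fstOp - A.comp sndOp) (sndOp - A.comp fstOp), fun v => ⟨?_, ?_⟩⟩
  · filter_upwards [hA v.snd, Lp.coeFn_sub v.fst (A v.snd)] with ρ h1 h2
    have : (pairOp (fstOp - A.comp sndOp) (sndOp - A.comp fstOp) v).fst = v.fst - A v.snd := rfl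
    rw [this, h2, Pi.sub_apply, h1]
  · filter_upwards [hA v.fst, Lp.coeFn_sub v.snd (A v.fst)] with ρ h1 h2
    have : (pairOp (fstOp - A.comp sndOp) (sndOp - A.comp fstOp) v).snd = v.snd - A v.fst := rfl
    rw [this, h2, Pi.sub_apply, h1]

/-- Multiplication of the half-wave profile by the independent variable. -/
def profileMul : Energy →L[ℂ] Energy := exists_profileMul.choose

theorem profileMul_fst (v : Energy) :
    (profileMul v).fst =ᵐ[unitMeasure] fun ρ => v.fst ρ - ρ * v.snd ρ :=
  (exists_profileMul.choose_spec v).1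

theorem profileMul_snd (v : Energy) :
    (profileMul v).snd =ᵐ[unitMeasure] fun ρ => v.snd ρ - ρ * v.fst ρ :=
  (exists_profileMul.choose_spec v).2

/-! ### Action on the monomials -/

theorem monoFst_succ (m : ℕ) (ρ : ℝ) :
    monoFst (m + 1) ρ = monoFst m ρ - ρ * monoSnd m ρ := by
  unfold monoFst monoSnd; ring

theorem monoSnd_succ (m : ℕ) (ρ : ℝ) :
    monoSnd (m + 1) ρ = monoSnd m ρ - ρ * monoFst m ρ := by
  unfold monoFst monoSnd; ring

theorem contDiff_monoFst (m : ℕ) {n : WithTop ℕ∞} : ContDiff ℝ n (monoFst m) := by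
  have : ContDiff ℝ n (fun ρ : ℝ => (ρ : ℂ)) := Complex.ofRealCLM.contDiff
  unfold monoFst; fun_prop

theorem contDiff_monoSnd (m : ℕ) {n : WithTop ℕ∞} : ContDiff ℝ n (monoSnd m) := by
  have : ContDiff ℝ n (fun ρ : ℝ => (ρ : ℂ)) := Complex.ofRealCLM.contDiff
  unfold monoSnd; fun_prop

theorem hasDerivAt_one_sub_pow (m : ℕ) (ρ : ℝ) :
    HasDerivAt (fun ρ : ℝ => (1 - (ρ : ℂ)) ^ (m + 1)) (-(m + 1) * (1 - (ρ : ℂ)) ^ m) ρ := by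
  have h : HasDerivAt (fun ρ : ℝ => 1 - (ρ : ℂ)) (-1) ρ :=
    (Complex.ofRealCLM.hasDerivAt (x := ρ)).const_sub 1
  refine (h.pow (m + 1)).congr_deriv ?_
  push_cast; simp; ring

theorem hasDerivAt_one_add_pow (m : ℕ) (ρ : ℝ) :
    HasDerivAt (fun ρ : ℝ => (1 + (ρ : ℂ)) ^ (m + 1)) ((m + 1) * (1 + (ρ : ℂ)) ^ m) ρ := by
  have h : HasDerivAt (fun ρ : ℝ => 1 + (ρ : ℂ)) 1 ρ :=
    (Complex.ofRealCLM.hasDerivAt (x := ρ)).const_add 1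
  refine (h.pow (m + 1)).congr_deriv ?_
  push_cast; simp

theorem hasDerivAt_monoFst (m : ℕ) (ρ : ℝ) :
    HasDerivAt (monoFst (m + 1)) (-(m + 1) * monoSnd m ρ) ρ := by
  refine (((hasDerivAt_one_sub_pow m ρ).sub (hasDerivAt_one_add_pow m ρ)).div_const 2).congr_deriv ?_
  unfold monoSnd; ring

theorem hasDerivAt_monoSnd (m : ℕ) (ρ : ℝ) :
    HasDerivAt (monoSnd (m + 1)) (-(m + 1) * monoFst m ρ) ρ := by
  refine (((hasDerivAt_one_sub_pow m ρ).add (hasDerivAt_one_add_pow m ρ)).div_const 2).congr_deriv ?_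
  unfold monoFst; ring

theorem derivWithin_unit {f : ℝ → ℂ} {f' : ℂ} {ρ : ℝ} (hρ : ρ ∈ Ioo (0 : ℝ) 1)
    (h : HasDerivAt f f' ρ) : derivWithin f (Icc 0 1) ρ = f' := by
  rw [derivWithin_of_mem_nhds (Icc_mem_nhds hρ.1 hρ.2), h.deriv]

theorem ae_mem_unit : ∀ᵐ ρ ∂unitMeasure, ρ ∈ Ioo (0 : ℝ) 1 := ae_restrict_mem measurableSet_Ioo

theorem profileMul_mono (m : ℕ) : profileMul (mono m) = mono (m + 1) := by
  apply energy_ext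
  · filter_upwards [profileMul_fst (mono m), mono_fst_ae m, mono_snd_ae m, mono_fst_ae (m + 1)]
      with ρ h1 h2 h3 h4
    rw [h1, h2, h3, h4, monoFst_succ]
  · filter_upwards [profileMul_snd (mono m), mono_fst_ae m, mono_snd_ae m, mono_snd_ae (m + 1)]
      with ρ h1 h2 h3 h4
    rw [h1, h2, h3, h4, monoSnd_succ]

/-! ### Classical pairs as primitives, and the graph of `L̃₀` -/

theorem primitive_eq_sub {f : ℝ → ℂ} (hf : ContDiffOn ℝ 1 f (Icc 0 1)) {g : L2}
    (hg : g =ᵐ[unitMeasure] derivWithin f (Icc 0 1)) {ρ : ℝ} (hρ : ρ ∈ Icc (0 : ℝ) 1) :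
    ∫ s in (0 : ℝ)..ρ, g s = f ρ - f 0 := by
  rw [integral_congr_unit hg hρ]
  refine intervalIntegral.integral_eq_sub_of_hasDeriv_right_of_le hρ.1
    (hf.continuousOn.mono (Icc_subset_Icc_right hρ.2)) (fun x hx => ?_) ?_
  · have hx' : x ∈ Ioo (0 : ℝ) 1 := Ioo_subset_Ioo_right hρ.2 hx
    have := (hf.differentiableOn one_ne_zero x (Ioo_subset_Icc_self hx')).hasDerivWithinAt
    exact (this.hasDerivAt (Icc_mem_nhds hx'.1 hx'.2)).hasDerivWithinAt
  · have hc := hf.continuousOn_derivWithin (uniqueDiffOn_Icc zero_lt_one) le_rfl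
    refine ContinuousOn.intervalIntegrable (hc.mono ?_)
    rw [uIcc_of_le hρ.1]; exact Icc_subset_Icc_right hρ.2

/-- A classical pair is recovered from its derivatives by integration. -/
theorem eq_mono_add_volterra {f₁ f₂ : ℝ → ℂ} (h1 : ContDiffOn ℝ 1 f₁ (Icc 0 1))
    (h2 : ContDiffOn ℝ 1 f₂ (Icc 0 1)) (h0 : f₁ 0 = 0) {u v : Energy}
    (hu1 : u.fst =ᵐ[unitMeasure] f₁) (hu2 : u.snd =ᵐ[unitMeasure] f₂)
    (hv1 : v.fst =ᵐ[unitMeasure] fun ρ => -derivWithin f₂ (Icc 0 1) ρ)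
    (hv2 : v.snd =ᵐ[unitMeasure] fun ρ => -derivWithin f₁ (Icc 0 1) ρ) :
    u = (f₁ 1 + f₂ 1) • mono 0 + volterra v := by
  have i1 : ∀ ρ ∈ Icc (0 : ℝ) 1, ∫ s in (0 : ℝ)..ρ, v.fst s = -(f₂ ρ - f₂ 0) := by
    intro ρ hρ
    have hn : (-v.fst : L2) =ᵐ[unitMeasure] derivWithin f₂ (Icc 0 1) := by
      filter_upwards [hv1, Lp.coeFn_neg v.fst] with s a b
      rw [b, Pi.neg_apply, a, neg_neg]
    rw [← primitive_eq_sub h2 hn hρ, integral_congr_unit (Lp.coeFn_neg v.fst) hρ]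
    simp
  have i2 : ∀ ρ ∈ Icc (0 : ℝ) 1, ∫ s in (0 : ℝ)..ρ, v.snd s = -(f₁ ρ - f₁ 0) := by
    intro ρ hρ
    have hn : (-v.snd : L2) =ᵐ[unitMeasure] derivWithin f₁ (Icc 0 1) := by
      filter_upwards [hv2, Lp.coeFn_neg v.snd] with s a b
      rw [b, Pi.neg_apply, a, neg_neg]
    rw [← primitive_eq_sub h1 hn hρ, integral_congr_unit (Lp.coeFn_neg v.snd) hρ]
    simp
  -- The constant of integration is the profile at `y = 0`, that is, at `ρ = 1`.
  set c := f₁ 1 + f₂ 1 with hc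
  apply energy_ext
  · filter_upwards [hu1, Lp.coeFn_add (c • (mono 0).fst) (volterra v).fst,
      Lp.coeFn_smul c (mono 0).fst, mono_fst_ae 0, volterra_fst v, ae_mem_unit]
      with ρ a1 a2 a3 a4 a5 a6
    have : (c • mono 0 + volterra v).fst = c • (mono 0).fst + (volterra v).fst := rfl
    rw [this, a1, a2, Pi.add_apply, a3, Pi.smul_apply, a4, a5, i2 ρ (Ioo_subset_Icc_self a6), h0]
    simp [monoFst]
  · filter_upwards [hu2, Lp.coeFn_add (c • (mono 0).snd) (volterra v).snd,
      Lp.coeFn_smul c (mono 0).snd, mono_snd_ae 0, volterra_snd v, ae_mem_unit]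
      with ρ a1 a2 a3 a4 a5 a6
    have : (c • mono 0 + volterra v).snd = c • (mono 0).snd + (volterra v).snd := rfl
    rw [this, a1, a2, Pi.add_apply, a3, Pi.smul_apply, a4, a5, i1 ρ (Ioo_subset_Icc_self a6),
      i1 1 one_mem_unit, i2 1 one_mem_unit, h0, hc]
    simp [monoSnd]; ring

theorem volterra_mono (m : ℕ) : volterra (mono m) = ((m : ℂ) + 1)⁻¹ • mono (m + 1) := by
  have hm : (m : ℂ) + 1 ≠ 0 := Nat.cast_add_one_ne_zero m
  have := eq_mono_add_volterra (contDiff_monoFst (m + 1)).contDiffOn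
    (contDiff_monoSnd (m + 1)).contDiffOn (by simp [monoFst]) (mono_fst_ae (m + 1))
    (mono_snd_ae (m + 1)) (v := ((m : ℂ) + 1) • mono m)
    (by
      filter_upwards [Lp.coeFn_smul ((m : ℂ) + 1) (mono m).fst, mono_fst_ae m, ae_mem_unit]
        with ρ a b c
      have : (((m : ℂ) + 1) • mono m).fst = ((m : ℂ) + 1) • (mono m).fst := rfl
      rw [this, a, Pi.smul_apply, b, derivWithin_unit c (hasDerivAt_monoSnd m ρ), smul_eq_mul]
      ring)
    (by
      filter_upwards [Lp.coeFn_smul ((m : ℂ) + 1) (mono m).snd, mono_snd_ae m, ae_mem_unit]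
        with ρ a b c
      have : (((m : ℂ) + 1) • mono m).snd = ((m : ℂ) + 1) • (mono m).snd := rfl
      rw [this, a, Pi.smul_apply, b, derivWithin_unit c (hasDerivAt_monoFst m ρ), smul_eq_mul]
      ring)
  have hz : monoFst (m + 1) 1 + monoSnd (m + 1) 1 = 0 := by
    simp [monoFst, monoSnd]; ring
  rw [hz, zero_smul, zero_add, map_smul] at this
  rw [this, smul_smul, inv_mul_cancel₀ hm, one_smul]

/-- This is `-y ∂_y y^m = -m y^m` on the folded components. -/
theorem mono_mem_preGeneratorGraph (m : ℕ) :
    (mono m, -(m : ℂ) • mono m) ∈ preGeneratorGraph := by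
  have hd : ∀ ρ : ℝ, ∃ d₁ d₂, HasDerivAt (monoFst m) d₁ ρ ∧ HasDerivAt (monoSnd m) d₂ ρ ∧
      -(ρ : ℂ) * d₁ + d₂ = -m * monoFst m ρ ∧ d₁ - ρ * d₂ = -m * monoSnd m ρ := by
    intro ρ
    cases m with
    | zero =>
      refine ⟨0, 0, ?_, ?_, by simp, by simp⟩
      · have : monoFst 0 = fun _ => 0 := by ext; simp [monoFst]
        rw [this]; exact hasDerivAt_const ρ (0 : ℂ)
      · have : monoSnd 0 = fun _ => 1 := by ext; simp [monoSnd]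
        rw [this]; exact hasDerivAt_const ρ (1 : ℂ)
    | succ m =>
      refine ⟨_, _, hasDerivAt_monoFst m ρ, hasDerivAt_monoSnd m ρ, ?_, ?_⟩
      · rw [monoFst_succ]; push_cast; ring
      · rw [monoSnd_succ]; push_cast; ring
  refine ⟨monoFst m, monoSnd m, (contDiff_monoFst m).contDiffOn, (contDiff_monoSnd m).contDiffOn,
    by simp [monoFst], mono_fst_ae m, mono_snd_ae m, ?_, ?_⟩
  · filter_upwards [Lp.coeFn_smul (-(m : ℂ)) (mono m).fst, mono_fst_ae m, ae_mem_unit]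
      with ρ a b c
    obtain ⟨d₁, d₂, e1, e2, e3, -⟩ := hd ρ
    have : (-(m : ℂ) • mono m).fst = -(m : ℂ) • (mono m).fst := rfl
    rw [derivWithin_unit c e1, derivWithin_unit c e2, e3]
    rw [this, a, Pi.smul_apply, b, smul_eq_mul]
  · filter_upwards [Lp.coeFn_smul (-(m : ℂ)) (mono m).snd, mono_snd_ae m, ae_mem_unit]
      with ρ a b c
    obtain ⟨d₁, d₂, e1, e2, -, e4⟩ := hd ρ
    have : (-(m : ℂ) • mono m).snd = -(m : ℂ) • (mono m).snd := rfl
    rw [derivWithin_unit c e1, derivWithin_unit c e2, e4]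
    rw [this, a, Pi.smul_apply, b, smul_eq_mul]

/-- The graph of `L̃₀` in terms of integration and multiplication. -/
theorem exists_of_mem_preGeneratorGraph {u v : Energy} (h : (u, v) ∈ preGeneratorGraph) :
    ∃ (c : ℂ) (w : Energy), u = c • mono 0 + volterra w ∧ v = -profileMul w := by
  obtain ⟨f₁, f₂, h1, h2, h0, hu1, hu2, hv1, hv2⟩ := h
  have hmem : ∀ f : ℝ → ℂ, ContDiffOn ℝ 1 f (Icc 0 1) →
      MemLp (fun ρ => -derivWithin f (Icc 0 1) ρ) 2 unitMeasure := by
    intro f hf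
    have hc := (hf.continuousOn_derivWithin (uniqueDiffOn_Icc zero_lt_one) le_rfl).neg
    obtain ⟨C, hC⟩ := isCompact_Icc.exists_bound_of_continuousOn hc
    exact MemLp.of_bound ((hc.mono Ioo_subset_Icc_self).aestronglyMeasurable measurableSet_Ioo) C
      (ae_mem_unit.mono fun ρ hρ => hC ρ (Ioo_subset_Icc_self hρ))
  -- `w` is the `y`-derivative of the profile: `∂_y = -∂_ρ` explains the sign, and the change of
  -- parity swaps the components.
  let w : Energy := WithLp.toLp 2 ((hmem f₂ h2).toLp, (hmem f₁ h1).toLp)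
  have hw1 : w.fst =ᵐ[unitMeasure] fun ρ => -derivWithin f₂ (Icc 0 1) ρ :=
    (hmem f₂ h2).coeFn_toLp
  have hw2 : w.snd =ᵐ[unitMeasure] fun ρ => -derivWithin f₁ (Icc 0 1) ρ :=
    (hmem f₁ h1).coeFn_toLp
  refine ⟨_, w, eq_mono_add_volterra h1 h2 h0 hu1 hu2 hw1 hw2, ?_⟩
  apply energy_ext
  · filter_upwards [hv1, hw1, hw2, profileMul_fst w, Lp.coeFn_neg (profileMul w).fst]
      with ρ a1 a2 a3 a4 a5
    have : (-profileMul w).fst = -(profileMul w).fst := rfl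
    rw [this, a5, Pi.neg_apply, a4, a2, a3]
    rw [a1]; ring
  · filter_upwards [hv2, hw1, hw2, profileMul_snd w, Lp.coeFn_neg (profileMul w).snd]
      with ρ a1 a2 a3 a4 a5
    have : (-profileMul w).snd = -(profileMul w).snd := rfl
    rw [this, a5, Pi.neg_apply, a4, a2, a3]
    rw [a1]; ring

/-! ### The free wave semigroup -/

theorem isC0Semigroup_of_mono {S : ℝ≥0 → Energy →L[ℂ] Energy} {C : ℝ} (hC : 0 < C)
    (hn : ∀ t, ‖S t‖ ≤ C * Real.exp (t / 2))
    (hS : ∀ t m, S t (mono m) = (Real.exp (-(m * t)) : ℂ) • mono m) : IsC0Semigroup S where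
  zero := ext_mono fun m => by simp [hS]
  add s t := ext_mono fun m => by
    rw [ContinuousLinearMap.comp_apply, hS, hS, map_smul, hS, smul_smul]
    congr 1
    rw [← Complex.ofReal_mul, ← Real.exp_add]
    congr 2
    push_cast; ring
  continuous := by
    let K : Submodule ℂ Energy :=
      { carrier := {x | Continuous fun t => S t x}
        zero_mem' := by simpa using continuous_const
        add_mem' := fun {a b} ha hb => by
          have : Continuous fun t => S t a + S t b := Continuous.add ha hb
          simpa using this
        smul_mem' := fun c a ha => by
          have : Continuous fun t => c • S t a := Continuous.const_smul ha c
          simpa using this }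
    -- The norms are bounded for `t < t₀ + 1`, so orbits of nearby vectors converge uniformly there
    -- and continuity survives the limit.
    have hK : IsClosed (K : Set Energy) := by
      refine isClosed_of_closure_subset fun x hx => ?_
      refine continuous_iff_continuousAt.2 fun t₀ =>
        continuousAt_of_locally_uniform_approx_of_continuousAt fun u hu => ?_
      obtain ⟨ε, hε, hu⟩ := Metric.mem_uniformity_dist.1 hu
      have hB : 0 < C * Real.exp ((t₀ + 1 : ℝ) / 2) := by positivity
      obtain ⟨x', hx', hd⟩ := Metric.mem_closure_iff.1 hx
        (ε / (C * Real.exp ((t₀ + 1 : ℝ) / 2))) (by positivity)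
      have hx' : Continuous fun t => S t x' := hx'
      refine ⟨Iio (t₀ + 1), Iio_mem_nhds (lt_add_one t₀), fun t => S t x', hx'.continuousAt,
        fun t ht => hu ?_⟩
      have ht' : (t : ℝ) < t₀ + 1 := by exact_mod_cast ht
      rw [dist_eq_norm, ← map_sub]
      calc ‖S t (x - x')‖ ≤ C * Real.exp ((t₀ + 1 : ℝ) / 2) * ‖x - x'‖ := by
            refine ((S t).le_opNorm _).trans ?_
            gcongr
            refine (hn t).trans ?_
            gcongr
        _ < ε := by rwa [← dist_eq_norm, mul_comm, ← lt_div_iff₀ hB]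
    refine fun x => mem_of_mono_mem K hK (fun m => ?_) x
    change Continuous fun t => S t (mono m)
    simp only [hS]
    refine Continuous.smul (Complex.continuous_ofReal.comp ?_) continuous_const
    fun_prop

theorem generatesAt_mono {S : ℝ≥0 → Energy →L[ℂ] Energy}
    (hS : ∀ t m, S t (mono m) = (Real.exp (-(m * t)) : ℂ) • mono m) (m : ℕ) :
    GeneratesAt S (mono m) (-(m : ℂ) • mono m) := by
  have hd : HasDerivAt (fun t : ℝ => Real.exp (-(m * t))) (-m) 0 := by
    have h1 : HasDerivAt (fun t : ℝ => -(m * t)) (-(m * 1)) 0 :=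
      ((hasDerivAt_id (0 : ℝ)).const_mul (m : ℝ)).neg
    simpa using h1.exp
  have ht := (hasDerivAt_iff_tendsto_slope.1 hd)
  have hc : Tendsto (fun h : ℝ≥0 => (h : ℝ)) (𝓝[>] 0) (𝓝[≠] 0) := by
    refine tendsto_nhdsWithin_iff.2 ⟨?_, ?_⟩
    · exact (NNReal.continuous_coe.tendsto 0).mono_left nhdsWithin_le_nhds
    · filter_upwards [self_mem_nhdsWithin] with h hh
      exact (NNReal.coe_pos.2 hh).ne'
  have := ((Complex.continuous_ofReal.tendsto _).comp (ht.comp hc)).smul_const (mono m)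
  rw [Complex.ofReal_neg, Complex.ofReal_natCast] at this
  refine this.congr fun h => ?_
  simp only [Function.comp, hS, slope_def_field]
  rw [smul_sub, smul_smul, ← sub_smul]
  congr 1
  simp [div_eq_inv_mul, mul_sub]

/-- The infinitesimal generator of the free wave semigroup is the closure of `L̃₀`. -/
theorem mem_closure_preGeneratorGraph_iff {S : ℝ≥0 → Energy →L[ℂ] Energy} {C : ℝ} (hC : 0 < C)
    (hn : ∀ t, ‖S t‖ ≤ C * Real.exp (t / 2))
    (hS : ∀ t m, S t (mono m) = (Real.exp (-(m * t)) : ℂ) • mono m) (u v : Energy) :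
    (u, v) ∈ preGeneratorGraph.topologicalClosure ↔ GeneratesAt S u v := by
  have hsg := isC0Semigroup_of_mono hC hn hS
  have hcl := isClosed_generatesAt hsg
  have h0 : GeneratesAt S 0 0 := by simp [GeneratesAt]
  let G : Submodule ℂ (Energy × Energy) :=
    { carrier := {p | GeneratesAt S p.1 p.2}
      zero_mem' := h0
      add_mem' := fun ha hb => GeneratesAt.add ha hb
      smul_mem' := fun c _ ha => GeneratesAt.smul ha c }
  -- A point of the graph is a multiple of `(1, 0)` plus `(V w, -y w)`. The latter depends boundedly
  -- on `w` and `G` is closed, so monomial `w` suffice; there it is a multiple of an eigenvector and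
  -- its image.
  have hpre : preGeneratorGraph ≤ G := by
    rintro ⟨u, v⟩ huv
    obtain ⟨c, w, rfl, rfl⟩ := exists_of_mem_preGeneratorGraph huv
    have hw : (volterra w, -profileMul w) ∈ G := by
      let A : Energy →L[ℂ] Energy × Energy := volterra.prod (-profileMul)
      refine mem_of_mono_mem (G.comap (A : Energy →ₗ[ℂ] Energy × Energy))
        (hcl.preimage A.continuous) (fun m => ?_) w
      change GeneratesAt S (volterra (mono m)) (-profileMul (mono m))
      rw [volterra_mono, profileMul_mono]
      have := (generatesAt_mono hS (m + 1)).smul ((m : ℂ) + 1)⁻¹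
      rw [smul_smul, mul_neg, Nat.cast_add_one,
        inv_mul_cancel₀ (Nat.cast_add_one_ne_zero m), neg_one_smul] at this
      exact this
    have h1 := (generatesAt_mono hS 0).smul c
    change GeneratesAt S (c • mono 0 + volterra w) (-profileMul w)
    simpa using GeneratesAt.add h1 hw
  constructor
  · intro h
    exact Submodule.topologicalClosure_minimal _ hpre hcl h
  · intro h
    -- `1 - L̃₀` has dense range, since it sends `y^m` to `(m + 1) y^m`.
    have hz : ∀ z : Energy, ∀ ε > 0, ∃ q : Energy × Energy, q ∈ preGeneratorGraph ∧
        ‖z - (q.1 - q.2)‖ < ε := by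
      let R : Submodule ℂ Energy := (preGeneratorGraph.map
        (LinearMap.fst ℂ Energy Energy - LinearMap.snd ℂ Energy Energy)).topologicalClosure
      have hR : ∀ m, mono m ∈ R := fun m => by
        refine Submodule.le_topologicalClosure _ ?_
        have hm : (m : ℂ) + 1 ≠ 0 := Nat.cast_add_one_ne_zero m
        refine ⟨((m : ℂ) + 1)⁻¹ • (mono m, -(m : ℂ) • mono m),
          Submodule.smul_mem _ _ (mono_mem_preGeneratorGraph m), ?_⟩
        rw [map_smul]
        change ((m : ℂ) + 1)⁻¹ • (mono m - -(m : ℂ) • mono m) = mono m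
        have : mono m - -(m : ℂ) • mono m = ((m : ℂ) + 1) • mono m := by
          rw [add_smul, one_smul, neg_smul]; abel
        rw [this, smul_smul, inv_mul_cancel₀ hm, one_smul]
      intro z ε hε
      have := mem_of_mono_mem R (Submodule.isClosed_topologicalClosure _) hR z
      obtain ⟨_, ⟨q, hq, rfl⟩, hd⟩ := Metric.mem_closure_iff.1 this ε hε
      exact ⟨q, hq, by rwa [dist_eq_norm] at hd⟩
    refine Metric.mem_closure_iff.2 fun ε hε => ?_
    -- If `a - b` is within `δ` of `u - v`, the resolvent estimate makes `a` within `2Cδ` of `u`,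
    -- hence `b` within `(2C + 1)δ` of `v`.
    obtain ⟨⟨a, b⟩, hq, hlt⟩ := hz (u - v) (ε / (2 * C + 1)) (by positivity)
    refine ⟨(a, b), hq, ?_⟩
    have hg : GeneratesAt S (u - a) (v - b) := h.sub (hpre hq)
    have h1 := hg.norm_le hsg hn
    have e : u - a - (v - b) = u - v - (a - b) := by abel
    rw [e] at h1
    have hlt' : ‖u - v - (a - b)‖ * (2 * C + 1) < ε := by
      rwa [lt_div_iff₀ (by positivity)] at hlt
    have h2 : ‖v - b‖ ≤ ‖u - a‖ + ‖u - v - (a - b)‖ := by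
      have : v - b = (u - a) - (u - v - (a - b)) := by abel
      rw [this]; exact norm_sub_le _ _
    have h3 := norm_nonneg (u - v - (a - b))
    rw [dist_eq_norm, Prod.norm_def, max_lt_iff]
    constructor
    · change ‖u - a‖ < ε; nlinarith
    · change ‖v - b‖ < ε; nlinarith

theorem dense_generatesAt {S : ℝ≥0 → Energy →L[ℂ] Energy}
    (hS : ∀ t m, S t (mono m) = (Real.exp (-(m * t)) : ℂ) • mono m) :
    Dense {x | ∃ y, GeneratesAt S x y} := by
  intro x
  let K : Submodule ℂ Energy := (Submodule.span ℂ (range mono)).topologicalClosure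
  have hx : x ∈ K := mem_of_mono_mem K (Submodule.isClosed_topologicalClosure _)
    (fun m => Submodule.le_topologicalClosure _ (Submodule.subset_span ⟨m, rfl⟩)) x
  refine closure_mono (fun z hz => ?_) hx
  induction hz using Submodule.span_induction with
  | mem z hz => obtain ⟨m, rfl⟩ := hz; exact ⟨_, generatesAt_mono hS m⟩
  | zero => exact ⟨0, by simp [GeneratesAt]⟩
  | add a b _ _ ha hb =>
    obtain ⟨a', ha'⟩ := ha
    obtain ⟨b', hb'⟩ := hb
    exact ⟨_, ha'.add hb'⟩
  | smul c a _ ha => obtain ⟨a', ha'⟩ := ha; exact ⟨_, ha'.smul c⟩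

/-- The free wave semigroup: generation, uniqueness, growth, and action on monomials. -/
theorem exists_free_semigroup : preGenerator.IsClosable ∧
    ∃ (S : ℝ≥0 → Energy →L[ℂ] Energy) (C : ℝ), 0 < C ∧
      (∀ t, ‖S t‖ ≤ C * Real.exp (t / 2)) ∧
      (∀ t m, S t (mono m) = (Real.exp (-(m * t)) : ℂ) • mono m) ∧
      IsSemigroupGeneratedBy S generator ∧
      ∀ T, IsSemigroupGeneratedBy T generator → T = S := by
  obtain ⟨S, C, hC, hn, hS⟩ := exists_dilation
  have hsg := isC0Semigroup_of_mono hC hn hS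
  have hiff := mem_closure_preGeneratorGraph_iff hC hn hS
  -- The closed graph is that of an infinitesimal generator, hence single valued by uniqueness of
  -- limits; this is closability.
  have hgr : preGeneratorGraph.topologicalClosure.toLinearPMap.graph =
      preGeneratorGraph.topologicalClosure := by
    refine Submodule.toLinearPMap_graph_eq _ ?_
    rintro ⟨u, v⟩ huv (rfl : u = 0)
    have h1 := (hiff 0 v).1 huv
    refine tendsto_nhds_unique h1 ?_
    simp
  have hclos : preGenerator.IsClosable := 
    ⟨preGeneratorGraph.topologicalClosure.toLinearPMap, by rw [preGenerator_graph, hgr]⟩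
  have hgen : ∀ u v, (u, v) ∈ generator.graph ↔ GeneratesAt S u v := by
    intro u v
    rw [generator, ← hclos.graph_closure_eq_closure_graph, preGenerator_graph]
    exact hiff u v
  refine ⟨hclos, S, C, hC, hn, hS, ⟨hsg.zero, hsg.add, hsg.continuous, hgen⟩, fun T hT => ?_⟩
  refine (IsC0Semigroup.eq_of_generatesAt hsg ⟨hT.zero, hT.add, hT.continuous⟩
    (fun x y hxy => (hT.generator x y).1 ((hgen x y).2 hxy)) (dense_generatesAt hS)).symm

/-- Substitution in `∫₀^{e^{-t}y} w = e^{-t} ∫₀^y w(e^{-t}s) ds`: each integration from the fixed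
point `y = 0` of the dilation gains a factor `e^{-t}`. -/
theorem semigroup_volterra {S : ℝ≥0 → Energy →L[ℂ] Energy}
    (hS : ∀ t m, S t (mono m) = (Real.exp (-(m * t)) : ℂ) • mono m) (t : ℝ≥0) (v : Energy) :
    S t (volterra v) = (Real.exp (-t) : ℂ) • volterra (S t v) := by
  have : (S t).comp volterra = (Real.exp (-t) : ℂ) • volterra.comp (S t) := by
    refine ext_mono fun m => ?_
    simp only [ContinuousLinearMap.comp_apply, smul_apply, volterra_mono,
      map_smul, hS]
    have e : (Real.exp (-((m + 1 : ℕ) * t)) : ℂ) = Real.exp (-t) * Real.exp (-(m * t)) := by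
      rw [← Complex.ofReal_mul, ← Real.exp_add]
      congr 2
      push_cast; ring
    rw [e]
    simp only [smul_smul]
    congr 1; ring
  exact congrArg (fun A : Energy →L[ℂ] Energy => A v) this

theorem semigroup_volterra_pow {S : ℝ≥0 → Energy →L[ℂ] Energy}
    (hS : ∀ t m, S t (mono m) = (Real.exp (-(m * t)) : ℂ) • mono m) (t : ℝ≥0) (n : ℕ)
    (v : Energy) :
    S t ((volterra ^ n) v) = (Real.exp (-(n * t)) : ℂ) • (volterra ^ n) (S t v) := by
  induction n generalizing v with
  | zero => simp
  | succ n ih =>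
    rw [pow_succ, mul_apply_eq_comp, mul_apply_eq_comp, ih,
      semigroup_volterra hS, map_smul, smul_smul, ← Complex.ofReal_mul, ← Real.exp_add]
    congr 4
    push_cast; ring

/-! ### Weak derivatives -/

/-- Integration against a continuous real function. -/
def testAgainst (ψ : ℝ → ℝ) (hψ : Continuous ψ) : L2 →L[ℂ] ℂ :=
  innerSL ℂ ((memLp_of_continuous (Complex.continuous_ofReal.comp hψ)).toLp _)

theorem testAgainst_apply (ψ : ℝ → ℝ) (hψ : Continuous ψ) (f : L2) :
    testAgainst ψ hψ f = ∫ x in Ioo (0 : ℝ) 1, (ψ x : ℂ) * f x := by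
  rw [testAgainst, innerSL_apply_apply, MeasureTheory.L2.inner_def]
  refine integral_congr_ae ?_
  filter_upwards [(memLp_of_continuous (Complex.continuous_ofReal.comp hψ)).coeFn_toLp] with x hx
  rw [hx]
  simp [mul_comm]

/-- In terms of bounded functionals, linearity is immediate and density of the monomials applies. -/
theorem isWeakDeriv_iff {n : ℕ} {f g : L2} : IsWeakDeriv n f g ↔
    ∀ (φ : ℝ → ℝ) (hφ : ContDiff ℝ ∞ φ), HasCompactSupport φ → tsupport φ ⊆ Ioo 0 1 →
      testAgainst (iteratedDeriv n φ)
        (hφ.continuous_iteratedDeriv n (by exact_mod_cast le_top)) f =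
        (-1) ^ n * testAgainst φ hφ.continuous g := by
  simp only [testAgainst_apply]; rfl

/-- The graph of the `n`-th weak derivative. -/
def weakDerivGraph (n : ℕ) : Submodule ℂ (L2 × L2) where
  carrier := {p | IsWeakDeriv n p.1 p.2}
  zero_mem' := isWeakDeriv_iff.2 fun φ _ _ _ => by simp
  add_mem' {p q} hp hq := isWeakDeriv_iff.2 fun φ h1 h2 h3 => by
    rw [Prod.fst_add, Prod.snd_add, map_add, map_add, isWeakDeriv_iff.1 hp φ h1 h2 h3,
      isWeakDeriv_iff.1 hq φ h1 h2 h3, mul_add]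
  smul_mem' c p hp := isWeakDeriv_iff.2 fun φ h1 h2 h3 => by
    rw [Prod.smul_fst, Prod.smul_snd, map_smul, map_smul, isWeakDeriv_iff.1 hp φ h1 h2 h3,
      mul_smul_comm]

theorem IsWeakDeriv.add {n : ℕ} {f g f' g' : L2} (h : IsWeakDeriv n f g)
    (h' : IsWeakDeriv n f' g') : IsWeakDeriv n (f + f') (g + g') :=
  (weakDerivGraph n).add_mem (x := (f, g)) (y := (f', g')) h h'

theorem IsWeakDeriv.sub {n : ℕ} {f g f' g' : L2} (h : IsWeakDeriv n f g)
    (h' : IsWeakDeriv n f' g') : IsWeakDeriv n (f - f') (g - g') :=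
  (weakDerivGraph n).sub_mem (x := (f, g)) (y := (f', g')) h h'

theorem IsWeakDeriv.neg {n : ℕ} {f g : L2} (h : IsWeakDeriv n f g) : IsWeakDeriv n (-f) (-g) :=
  (weakDerivGraph n).neg_mem (x := (f, g)) h

theorem IsWeakDeriv.smul {n : ℕ} {f g : L2} (c : ℂ) (h : IsWeakDeriv n f g) :
    IsWeakDeriv n (c • f) (c • g) :=
  (weakDerivGraph n).smul_mem c (x := (f, g)) h

theorem isWeakDeriv_zero (f : L2) : IsWeakDeriv 0 f f := fun φ _ _ _ => by simp

theorem isWeakDeriv_weakDeriv {n : ℕ} {f : L2} (h : ∃ g, IsWeakDeriv n f g) :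
    IsWeakDeriv n f (weakDeriv n f) := by
  obtain ⟨g, hg⟩ := h
  rwa [hg.weakDeriv_eq]

theorem contDiff_deriv_test {φ : ℝ → ℝ} (hφ : ContDiff ℝ ∞ φ) : ContDiff ℝ ∞ (deriv φ) :=
  (contDiff_infty_iff_deriv.1 hφ).2

theorem tsupport_deriv_test {φ : ℝ → ℝ} (h : tsupport φ ⊆ Ioo 0 1) :
    tsupport (deriv φ) ⊆ Ioo 0 1 :=
  (closure_minimal (support_deriv_subset) (isClosed_tsupport φ)).trans h

theorem IsWeakDeriv.trans {n : ℕ} {f g h : L2} (h1 : IsWeakDeriv n f g) (h2 : IsWeakDeriv 1 g h) :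
    IsWeakDeriv (n + 1) f h := by
  intro φ hφ hs ht
  have e1 := h1 (deriv φ) (contDiff_deriv_test hφ) hs.deriv (tsupport_deriv_test ht)
  have e2 := h2 φ hφ hs ht
  rw [iteratedDeriv_one] at e2
  rw [iteratedDeriv_succ', e1, e2]
  ring

/-- Testing the `n`-th order identity with `φ'` and comparing with order `n + 1` leaves the
first-order identity. -/
theorem IsWeakDeriv.of_succ {n : ℕ} {f g h : L2} (h1 : IsWeakDeriv n f g)
    (h2 : IsWeakDeriv (n + 1) f h) : IsWeakDeriv 1 g h := by
  intro φ hφ hs ht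
  have e1 := h1 (deriv φ) (contDiff_deriv_test hφ) hs.deriv (tsupport_deriv_test ht)
  have e2 := h2 φ hφ hs ht
  rw [iteratedDeriv_succ', e1] at e2
  rw [iteratedDeriv_one]
  refine mul_left_cancel₀ (pow_ne_zero n (by norm_num : (-1 : ℂ) ≠ 0)) (e2.trans ?_)
  ring

theorem L2.integrable_test_mul (f : L2) {ψ : ℝ → ℝ} (hψ : Continuous ψ) :
    Integrable (fun x => (ψ x : ℂ) * f x) unitMeasure :=
  (memLp_of_continuous (Complex.continuous_ofReal.comp hψ)).integrable_mul (Lp.memLp f)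

theorem test_eq_zero {φ : ℝ → ℝ} (ht : tsupport φ ⊆ Ioo 0 1) {x : ℝ} (hx : x ∉ Ioo (0 : ℝ) 1) :
    φ x = 0 :=
  image_eq_zero_of_notMem_tsupport fun h => hx (ht h)

/-- Integration by parts; the test function kills both boundary terms. -/
theorem isWeakDeriv_of_hasDerivAt {F F' : ℝ → ℂ} (hF : ∀ x, HasDerivAt F (F' x) x)
    (hc : Continuous F') {f g : L2} (hf : f =ᵐ[unitMeasure] F) (hg : g =ᵐ[unitMeasure] F') :
    IsWeakDeriv 1 f g := by
  intro φ hφ hs ht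
  have hd : ∀ x, HasDerivAt (fun x => (φ x : ℂ)) ((deriv φ x : ℝ) : ℂ) x := fun x =>
    ((hφ.differentiable (by simp) x).hasDerivAt).ofReal_comp
  have hcF : Continuous F := continuous_iff_continuousAt.2 fun x => (hF x).continuousAt
  have hcφ : Continuous fun x => ((deriv φ x : ℝ) : ℂ) :=
    Complex.continuous_ofReal.comp (contDiff_deriv_test hφ).continuous
  have key := intervalIntegral.integral_deriv_mul_eq_sub (a := 0) (b := 1)
    (fun x _ => hd x) (fun x _ => hF x) (hcφ.intervalIntegrable _ _) (hc.intervalIntegrable _ _)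
  rw [test_eq_zero ht (by simp : (1 : ℝ) ∉ Ioo (0 : ℝ) 1),
    test_eq_zero ht (by simp : (0 : ℝ) ∉ Ioo (0 : ℝ) 1)] at key
  have hcφ' : Continuous fun x => (φ x : ℂ) := Complex.continuous_ofReal.comp hφ.continuous
  have hadd := intervalIntegral.integral_add (μ := volume) (a := 0) (b := 1)
    (f := fun x => ((deriv φ x : ℝ) : ℂ) * F x) (g := fun x => (φ x : ℂ) * F' x)
    ((hcφ.mul hcF).intervalIntegrable _ _) ((hcφ'.mul hc).intervalIntegrable _ _)
  rw [hadd] at key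
  simp only [intervalIntegral.integral_of_le zero_le_one, integral_Ioc_eq_integral_Ioo,
    Complex.ofReal_zero, zero_mul, sub_zero] at key
  have e1 : ∫ x in Ioo (0 : ℝ) 1, ((iteratedDeriv 1 φ x : ℝ) : ℂ) * f x =
      ∫ x in Ioo (0 : ℝ) 1, ((deriv φ x : ℝ) : ℂ) * F x := by
    refine integral_congr_ae ?_
    filter_upwards [hf] with x hx
    rw [hx, iteratedDeriv_one]
  have e2 : ∫ x in Ioo (0 : ℝ) 1, (φ x : ℂ) * g x = ∫ x in Ioo (0 : ℝ) 1, (φ x : ℂ) * F' x := by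
    refine integral_congr_ae ?_
    filter_upwards [hg] with x hx
    rw [hx]
  rw [e1, e2, eq_neg_of_add_eq_zero_left key]; ring

/-- For monomials the derivatives are classical. For each test function both sides are bounded
functionals of `v`, so density finishes. -/
theorem isWeakDeriv_volterra (v : Energy) :
    IsWeakDeriv 1 (volterra v).fst (-v.snd) ∧ IsWeakDeriv 1 (volterra v).snd (-v.fst) := by
  have base : ∀ m, IsWeakDeriv 1 (volterra (mono m)).fst (-(mono m).snd) ∧
      IsWeakDeriv 1 (volterra (mono m)).snd (-(mono m).fst) := by
    intro m
    have hm : (m : ℂ) + 1 ≠ 0 := Nat.cast_add_one_ne_zero m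
    rw [volterra_mono]
    constructor
    · have := (isWeakDeriv_of_hasDerivAt (hasDerivAt_monoFst m)
        (continuous_const.mul (continuous_monoSnd m)) (mono_fst_ae (m + 1))
        (g := -((m : ℂ) + 1) • (mono m).snd) (by
          filter_upwards [mono_snd_ae m, Lp.coeFn_smul (-((m : ℂ) + 1)) (mono m).snd] with x h1 h2
          rw [h2, Pi.smul_apply, h1, smul_eq_mul])).smul ((m : ℂ) + 1)⁻¹
      rwa [smul_smul, mul_neg, inv_mul_cancel₀ hm, neg_one_smul] at this
    · have := (isWeakDeriv_of_hasDerivAt (hasDerivAt_monoSnd m)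
        (continuous_const.mul (continuous_monoFst m)) (mono_snd_ae (m + 1))
        (g := -((m : ℂ) + 1) • (mono m).fst) (by
          filter_upwards [mono_fst_ae m, Lp.coeFn_smul (-((m : ℂ) + 1)) (mono m).fst] with x h1 h2
          rw [h2, Pi.smul_apply, h1, smul_eq_mul])).smul ((m : ℂ) + 1)⁻¹
      rwa [smul_smul, mul_neg, inv_mul_cancel₀ hm, neg_one_smul] at this
  constructor
  · refine isWeakDeriv_iff.2 fun φ h1 h2 h3 => ?_
    have : ((testAgainst (iteratedDeriv 1 φ)
        (h1.continuous_iteratedDeriv 1 (by exact_mod_cast le_top))).comp fstOp).comp volterra =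
        -((-1 : ℂ) ^ 1 • (testAgainst φ h1.continuous).comp sndOp) := ext_mono fun m => by
      have := isWeakDeriv_iff.1 (base m).1 φ h1 h2 h3
      rw [map_neg, mul_neg] at this
      exact this
    have := congrArg (fun A : Energy →L[ℂ] ℂ => A v) this
    rw [map_neg, mul_neg]
    exact this
  · refine isWeakDeriv_iff.2 fun φ h1 h2 h3 => ?_
    have : ((testAgainst (iteratedDeriv 1 φ)
        (h1.continuous_iteratedDeriv 1 (by exact_mod_cast le_top))).comp sndOp).comp volterra =
        -((-1 : ℂ) ^ 1 • (testAgainst φ h1.continuous).comp fstOp) := ext_mono fun m => by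
      have := isWeakDeriv_iff.1 (base m).2 φ h1 h2 h3
      rw [map_neg, mul_neg] at this
      exact this
    have := congrArg (fun A : Energy →L[ℂ] ℂ => A v) this
    rw [map_neg, mul_neg]
    exact this

/-! ### The du Bois-Reymond lemma -/

/-- A test function of mean zero is the derivative of a test function. -/
theorem exists_test_primitive {χ : ℝ → ℝ} (hχ : ContDiff ℝ ∞ χ) (hs : HasCompactSupport χ)
    (ht : tsupport χ ⊆ Ioo 0 1) (h0 : ∫ x in (0 : ℝ)..1, χ x = 0) :
    ∃ φ : ℝ → ℝ, ContDiff ℝ ∞ φ ∧ HasCompactSupport φ ∧ tsupport φ ⊆ Ioo 0 1 ∧ deriv φ = χ := by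
  have hd : ∀ x, HasDerivAt (fun x => ∫ s in (0 : ℝ)..x, χ s) (χ x) x := fun x =>
    (hχ.continuous.integral_hasStrictDerivAt 0 x).hasDerivAt
  have hderiv : deriv (fun x => ∫ s in (0 : ℝ)..x, χ s) = χ := funext fun x => (hd x).deriv
  obtain ⟨a, b, ha, hb, hab⟩ : ∃ a b : ℝ, 0 < a ∧ b < 1 ∧ tsupport χ ⊆ Icc a b := by
    rcases (tsupport χ).eq_empty_or_nonempty with h | h
    · exact ⟨1, 0, one_pos, zero_lt_one, by simp [h]⟩
    · have hc : IsCompact (tsupport χ) := hs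
      obtain ⟨a, haχ, ha⟩ := hc.exists_isLeast h
      obtain ⟨b, hbχ, hb⟩ := hc.exists_isGreatest h
      exact ⟨a, b, (ht haχ).1, (ht hbχ).2, fun x hx => ⟨ha hx, hb hx⟩⟩
  have hz : ∀ x, x ∉ Icc a b → χ x = 0 := fun x hx =>
    image_eq_zero_of_notMem_tsupport fun h => hx (hab h)
  have hsupp : Function.support (fun x => ∫ s in (0 : ℝ)..x, χ s) ⊆ Icc a b := by
    intro x hx
    by_contra hcon
    refine hx ?_
    rcases not_and_or.1 hcon with h | h
    · refine intervalIntegral.integral_zero_ae (Eventually.of_forall fun s hs => hz s fun hs' => ?_)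
      have := hs.2
      rcases le_max_iff.1 this with h2 | h2
      · exact absurd (h2.trans_lt ha) (not_lt.2 hs'.1)
      · exact h (hs'.1.trans h2)
    · have e := intervalIntegral.integral_add_adjacent_intervals (μ := volume)
        (hχ.continuous.intervalIntegrable 0 x) (hχ.continuous.intervalIntegrable x 1)
      have e2 : ∫ s in x..(1 : ℝ), χ s = 0 := by
        refine intervalIntegral.integral_zero_ae
          (Eventually.of_forall fun s hs => hz s fun hs' => ?_)
        have := hs.1
        rcases min_lt_iff.1 this with h2 | h2
        · exact h (h2.le.trans hs'.2)
        · exact absurd (hs'.2.trans_lt hb) (not_lt.2 h2.le)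
      change ∫ s in (0 : ℝ)..x, χ s = 0
      linarith
  have hts : tsupport (fun x => ∫ s in (0 : ℝ)..x, χ s) ⊆ Icc a b :=
    closure_minimal hsupp isClosed_Icc
  refine ⟨fun x => ∫ s in (0 : ℝ)..x, χ s, ?_, ?_, ?_, hderiv⟩
  · exact contDiff_infty_iff_deriv.2 ⟨fun x => (hd x).differentiableAt, by rwa [hderiv]⟩
  · exact isCompact_Icc.of_isClosed_subset (isClosed_tsupport _) hts
  · exact hts.trans fun x hx => ⟨ha.trans_le hx.1, hx.2.trans_lt hb⟩

theorem exists_test_integral_one : ∃ ψ : ℝ → ℝ, ContDiff ℝ ∞ ψ ∧ HasCompactSupport ψ ∧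
    tsupport ψ ⊆ Ioo 0 1 ∧ ∫ x in (0 : ℝ)..1, ψ x = 1 := by
  let b : ContDiffBump (1 / 2 : ℝ) := ⟨1 / 8, 1 / 4, by norm_num, by norm_num⟩
  have hts : tsupport (b.normed volume) ⊆ Ioo 0 1 := by
    rw [b.tsupport_normed_eq, Real.closedBall_eq_Icc]
    intro x hx
    have h1 : (1 / 2 : ℝ) - 1 / 4 ≤ x := hx.1
    have h2 : x ≤ (1 / 2 : ℝ) + 1 / 4 := hx.2
    constructor <;> linarith
  refine ⟨b.normed volume, b.contDiff_normed, b.hasCompactSupport_normed, hts, ?_⟩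
  rw [intervalIntegral.integral_of_le zero_le_one, integral_Ioc_eq_integral_Ioo,
    setIntegral_eq_integral_of_forall_compl_eq_zero fun x hx => test_eq_zero hts hx]
  exact b.integral_normed

/-- Fix `ψ` of integral one and take `c = ∫ ψ f`. For any test function `χ`, `χ - (∫ χ) ψ` has mean
zero, so it is the derivative of a test function and is annihilated by `f`; hence `∫ χ (f - c) = 0`.
-/
theorem ae_const_of_isWeakDeriv_zero {f : L2} (h : IsWeakDeriv 1 f 0) :
    ∃ c : ℂ, f =ᵐ[unitMeasure] fun _ => c := by
  obtain ⟨ψ, hψ, hψs, hψt, hψ1⟩ := exists_test_integral_one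
  have hψc := hψ.continuous
  refine ⟨testAgainst ψ hψc f, ?_⟩
  set c := testAgainst ψ hψc f with hc
  have hint : Integrable (fun x => f x - c) unitMeasure := f.integrable.sub (integrable_const c)
  have key := isOpen_Ioo.ae_eq_zero_of_integral_contDiff_smul_eq_zero
    (U := Ioo (0 : ℝ) 1) (μ := volume) (f := fun x => f x - c)
    (IntegrableOn.locallyIntegrableOn hint) (by
      intro χ hχ hs ht
      have hχc := hχ.continuous
      set I := ∫ x in (0 : ℝ)..1, χ x with hI
      have hsub : tsupport (fun x => χ x - I * ψ x) ⊆ tsupport χ ∪ tsupport ψ := by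
        refine closure_minimal (fun x hx => ?_) ((isClosed_tsupport _).union (isClosed_tsupport _))
        by_contra hcon
        rw [mem_union, not_or] at hcon
        refine hx ?_
        simp [image_eq_zero_of_notMem_tsupport hcon.1, image_eq_zero_of_notMem_tsupport hcon.2]
      have hsplit := intervalIntegral.integral_sub (μ := volume) (a := 0) (b := 1) (f := χ)
        (g := fun x => I * ψ x) (hχc.intervalIntegrable _ _)
        ((continuous_const.mul hψc).intervalIntegrable _ _)
      obtain ⟨φ, hφ, hφs, hφt, hφd⟩ := exists_test_primitive
        (χ := fun x => χ x - I * ψ x) (hχ.sub (contDiff_const.mul hψ))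
        ((IsCompact.union hs hψs).of_isClosed_subset (isClosed_tsupport _) hsub)
        (hsub.trans (union_subset ht hψt))
        (by rw [hsplit, intervalIntegral.integral_const_mul, hψ1, mul_one, sub_self])
      have e1 := h φ hφ hφs hφt
      have e0 : ∫ x in Ioo (0 : ℝ) 1, (φ x : ℂ) * (0 : L2) x = 0 := by
        rw [← testAgainst_apply φ hφ.continuous, map_zero]
      rw [e0, mul_zero, iteratedDeriv_one, hφd] at e1
      have e2 : ∫ x in Ioo (0 : ℝ) 1, ((χ x - I * ψ x : ℝ) : ℂ) * f x =
          (∫ x in Ioo (0 : ℝ) 1, (χ x : ℂ) * f x) - I * c := by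
        rw [hc, testAgainst_apply, ← integral_const_mul,
          ← integral_sub (f.integrable_test_mul hχc) ((f.integrable_test_mul hψc).const_mul _)]
        refine integral_congr_ae (Eventually.of_forall fun x => ?_)
        push_cast; ring
      have e3 : ∫ x in Ioo (0 : ℝ) 1, (χ x : ℂ) * (f x - c) =
          (∫ x in Ioo (0 : ℝ) 1, (χ x : ℂ) * f x) - I * c := by
        have hχi : Integrable (fun x => (χ x : ℂ)) unitMeasure :=
          (memLp_of_continuous (Complex.continuous_ofReal.comp hχc)).integrable (by norm_num)
        have hIc : (I : ℂ) = ∫ x in Ioo (0 : ℝ) 1, (χ x : ℂ) := by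
          rw [hI, intervalIntegral.integral_of_le zero_le_one, integral_Ioc_eq_integral_Ioo,
            integral_complex_ofReal]
        rw [hIc, ← integral_mul_const,
          ← integral_sub (f.integrable_test_mul hχc) (hχi.mul_const _)]
        refine integral_congr_ae (Eventually.of_forall fun x => ?_)
        simp only; ring
      have e4 : ∫ x, χ x • (f x - c) = ∫ x in Ioo (0 : ℝ) 1, (χ x : ℂ) * (f x - c) := by
        rw [← setIntegral_eq_integral_of_forall_compl_eq_zero (s := Ioo (0 : ℝ) 1)
          fun x hx => by rw [test_eq_zero ht hx, zero_smul]]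
        refine integral_congr_ae (Eventually.of_forall fun x => ?_)
        simp
      rw [e4, e3, ← e2, e1])
  have := (ae_restrict_iff' measurableSet_Ioo).2 key
  filter_upwards [this] with x hx using sub_eq_zero.1 hx

/-! ### Sobolev regularity as iterated integration -/

theorem VanishesAtZero.add {f g : L2} (hf : VanishesAtZero f) (hg : VanishesAtZero g) :
    VanishesAtZero (f + g) := by
  obtain ⟨F, hF, hfF, hF0⟩ := hf
  obtain ⟨G, hG, hgG, hG0⟩ := hg
  exact ⟨F + G, hF.add hG, (Lp.coeFn_add f g).trans (hfF.add hgG), by simp [hF0, hG0]⟩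

theorem VanishesAtZero.neg {f : L2} (hf : VanishesAtZero f) : VanishesAtZero (-f) := by
  obtain ⟨F, hF, hfF, hF0⟩ := hf
  exact ⟨-F, hF.neg, (Lp.coeFn_neg f).trans hfF.neg, by simp [hF0]⟩

theorem vanishesAtZero_volterra_fst (v : Energy) : VanishesAtZero (volterra v).fst :=
  ⟨_, v.snd.continuousOn_primitive.neg, volterra_fst v, by simp⟩

theorem VanishesAtZero.eq_zero_of_ae_const {f : L2} (hf : VanishesAtZero f) {c : ℂ}
    (hc : f =ᵐ[unitMeasure] fun _ => c) : f = 0 := by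
  obtain ⟨F, hF, hfF, hF0⟩ := hf
  have hEq : EqOn F (fun _ => c) (Ioo 0 1) :=
    Measure.eqOn_open_of_ae_eq (hfF.symm.trans hc) isOpen_Ioo
      (hF.mono Ioo_subset_Icc_self) continuousOn_const
  have hEq' : EqOn F (fun _ => c) (Icc 0 1) :=
    hEq.of_subset_closure hF continuousOn_const Ioo_subset_Icc_self
      (by rw [closure_Ioo zero_ne_one])
  have hc0 : c = 0 := by rw [← hF0]; exact (hEq' zero_mem_unit).symm
  apply Lp.ext
  filter_upwards [hc, Lp.coeFn_zero ℂ 2 unitMeasure] with x h1 h2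
  rw [h1, h2, hc0]; rfl

theorem mono_zero_fst : (mono 0).fst = 0 := by
  apply Lp.ext
  filter_upwards [mono_fst_ae 0, Lp.coeFn_zero ℂ 2 unitMeasure] with x h1 h2
  rw [h1, h2]; simp [monoFst]

theorem mono_zero_snd_ae : (mono 0).snd =ᵐ[unitMeasure] fun _ => 1 := by
  filter_upwards [mono_snd_ae 0] with x h1
  rw [h1]; simp [monoSnd]

theorem isWeakDeriv_mono_zero_snd : IsWeakDeriv 1 (mono 0).snd 0 := by
  refine isWeakDeriv_of_hasDerivAt (F := fun _ => 1) (F' := fun _ => 0)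
    (fun x => hasDerivAt_const x _) continuous_const mono_zero_snd_ae ?_
  filter_upwards [Lp.coeFn_zero ℂ 2 unitMeasure] with x h using h

/-- Half-wave profiles that are primitives are characterized by first-order weak derivatives and
the boundary condition at the origin. -/
theorem exists_eq_mono_add_volterra {u v : Energy} (h1 : IsWeakDeriv 1 u.fst (-v.snd))
    (h2 : IsWeakDeriv 1 u.snd (-v.fst)) (h0 : VanishesAtZero u.fst) :
    ∃ c : ℂ, u = c • mono 0 + volterra v := by
  have k1 := h1.sub (isWeakDeriv_volterra v).1
  have k2 := h2.sub (isWeakDeriv_volterra v).2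
  rw [sub_self] at k1 k2
  -- Both components of `u - V v` are constant. The boundary condition kills the odd one; the even
  -- one is a multiple of the profile `1`.
  obtain ⟨c₁, hc₁⟩ := ae_const_of_isWeakDeriv_zero k1
  obtain ⟨c, hc⟩ := ae_const_of_isWeakDeriv_zero k2
  have hv : VanishesAtZero (u.fst - (volterra v).fst) := by
    rw [sub_eq_add_neg]; exact h0.add (vanishesAtZero_volterra_fst v).neg
  have z := hv.eq_zero_of_ae_const hc₁
  have z' : u.snd - (volterra v).snd = c • (mono 0).snd := by
    apply Lp.ext
    filter_upwards [hc, Lp.coeFn_smul c (mono 0).snd, mono_zero_snd_ae] with x a1 a2 a3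
    rw [a1, a2, Pi.smul_apply, a3, smul_eq_mul, mul_one]
  refine ⟨c, WithLp.ofLp_injective 2 (Prod.ext ?_ ?_)⟩
  · change u.fst = c • (mono 0).fst + (volterra v).fst
    rw [mono_zero_fst, smul_zero, zero_add]; exact sub_eq_zero.1 z
  · change u.snd = c • (mono 0).snd + (volterra v).snd
    rw [← z', sub_add_cancel]

theorem isWeakDeriv_mono_add_volterra (c : ℂ) (v : Energy) :
    IsWeakDeriv 1 (c • mono 0 + volterra v).fst (-v.snd) ∧
    IsWeakDeriv 1 (c • mono 0 + volterra v).snd (-v.fst) ∧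
    VanishesAtZero (c • mono 0 + volterra v).fst := by
  have e1 : (c • mono 0 + volterra v).fst = (volterra v).fst := by
    change c • (mono 0).fst + (volterra v).fst = _
    rw [mono_zero_fst, smul_zero, zero_add]
  refine ⟨?_, ?_, ?_⟩
  · rw [e1]; exact (isWeakDeriv_volterra v).1
  · have := (isWeakDeriv_mono_zero_snd.smul c).add (isWeakDeriv_volterra v).2
    rwa [smul_zero, zero_add] at this
  · rw [e1]; exact vanishesAtZero_volterra_fst v

theorem mono_eq_volterra_pow (n : ℕ) : mono n = (n.factorial : ℂ) • (volterra ^ n) (mono 0) := by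
  induction n with
  | zero => simp
  | succ n ih =>
    have hn : (n : ℂ) + 1 ≠ 0 := Nat.cast_add_one_ne_zero n
    rw [pow_succ', mul_apply_eq_comp, Nat.factorial_succ, Nat.cast_mul, mul_smul, ← map_smul, ← ih,
      volterra_mono, smul_smul, Nat.cast_add_one, mul_inv_cancel₀ hn, one_smul]

theorem diffOp_zero (u : Energy) : diffOp 0 u = u :=
  WithLp.ofLp_injective 2
    (Prod.ext (isWeakDeriv_zero u.fst).weakDeriv_eq (isWeakDeriv_zero u.snd).weakDeriv_eq)

/-- One more Taylor term splits off, because `V^n 1 = y^n / n!`. -/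
theorem exists_sum_succ {n : ℕ} {u w : Energy} {a : ℂ} {c : ℕ → ℂ}
    (h : u = ∑ m ∈ Finset.range n, c m • mono m + (volterra ^ n) (a • mono 0 + volterra w)) :
    ∃ c : ℕ → ℂ, u = ∑ m ∈ Finset.range (n + 1), c m • mono m + (volterra ^ (n + 1)) w := by
  refine ⟨Function.update c n (a / n.factorial), ?_⟩
  have hn : (n.factorial : ℂ) ≠ 0 := Nat.cast_ne_zero.2 n.factorial_ne_zero
  have e : ∑ m ∈ Finset.range n, Function.update c n (a / n.factorial) m • mono m =
      ∑ m ∈ Finset.range n, c m • mono m := Finset.sum_congr rfl fun m hm => by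
    rw [Function.update_of_ne (Finset.mem_range.1 hm).ne]
  rw [Finset.sum_range_succ, e, Function.update_self, mono_eq_volterra_pow n, smul_smul,
    div_mul_cancel₀ _ hn, h, map_add, map_smul, pow_succ, mul_apply_eq_comp, add_assoc]

theorem sobolevSpace_succ_subset (k : ℕ) : sobolevSpace (k + 1) ⊆ sobolevSpace k :=
  fun _ hu => ⟨fun n hn => hu.1 n (by omega), fun n hn => hu.2.1 n (by omega),
    fun j hj => hu.2.2 j (by omega)⟩

/-- Taylor expansion of the half-wave profile at `0`. -/
theorem exists_taylor {k : ℕ} {u : Energy} (hu : u ∈ sobolevSpace k) :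
    ∃ c : ℕ → ℂ, u = ∑ m ∈ Finset.range (2 * k), c m • mono m +
      (volterra ^ (2 * k)) (diffOp k u) := by
  induction k with
  | zero => exact ⟨0, by simp [diffOp_zero]⟩
  | succ k ih =>
    obtain ⟨c, hc⟩ := ih (sobolevSpace_succ_subset k hu)
    have w1 : ∀ n ≤ 2 * (k + 1), IsWeakDeriv n u.fst (weakDeriv n u.fst) := fun n hn =>
      isWeakDeriv_weakDeriv (hu.1 n hn)
    have w2 : ∀ n ≤ 2 * (k + 1), IsWeakDeriv n u.snd (weakDeriv n u.snd) := fun n hn =>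
      isWeakDeriv_weakDeriv (hu.2.1 n hn)
    -- The profile of `v` is the `y`-derivative of order `2k + 1`. The swap makes `u₂^{(2k+1)}(0) =
    -- 0` the vanishing condition on its first component.
    let v : Energy := WithLp.toLp 2 (-weakDeriv (2 * k + 1) u.snd, -weakDeriv (2 * k + 1) u.fst)
    obtain ⟨a, ha⟩ := exists_eq_mono_add_volterra (u := diffOp k u) (v := v)
      (by
        change IsWeakDeriv 1 (weakDeriv (2 * k) u.fst) (- -weakDeriv (2 * k + 1) u.fst)
        rw [neg_neg]; exact (w1 _ (by omega)).of_succ (w1 _ (by omega)))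
      (by
        change IsWeakDeriv 1 (weakDeriv (2 * k) u.snd) (- -weakDeriv (2 * k + 1) u.snd)
        rw [neg_neg]; exact (w2 _ (by omega)).of_succ (w2 _ (by omega)))
      (hu.2.2 k (by omega)).1
    obtain ⟨b, hb⟩ := exists_eq_mono_add_volterra (u := v) (v := diffOp (k + 1) u)
      ((w2 (2 * k + 1) (by omega)).of_succ (w2 (2 * k + 1 + 1) (by omega))).neg
      ((w1 (2 * k + 1) (by omega)).of_succ (w1 (2 * k + 1 + 1) (by omega))).neg
      (hu.2.2 k (by omega)).2.neg
    rw [ha] at hc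
    obtain ⟨c', hc'⟩ := exists_sum_succ hc
    rw [hb] at hc'
    exact exists_sum_succ hc'

theorem mem_sobolevSpace_of_taylor {k : ℕ} {u h : Energy} {c : ℕ → ℂ}
    (hu : u = ∑ m ∈ Finset.range (2 * k), c m • mono m + (volterra ^ (2 * k)) h) :
    u ∈ sobolevSpace k ∧ diffOp k u = h := by
  induction k generalizing h with
  | zero =>
    have : u = h := by simpa using hu
    subst this
    refine ⟨⟨fun n hn => ?_, fun n hn => ?_, fun j hj => absurd hj (by simp)⟩, diffOp_zero u⟩
    · obtain rfl : n = 0 := by omega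
      exact ⟨_, isWeakDeriv_zero _⟩
    · obtain rfl : n = 0 := by omega
      exact ⟨_, isWeakDeriv_zero _⟩
  | succ k ih =>
    -- The last two Taylor terms and the remainder merge into `V^{2k} a`. Differentiating `a` twice
    -- gives `v`, then `h`, up to signs that cancel.
    set v : Energy := (c (2 * k + 1) * (2 * k + 1).factorial) • mono 0 + volterra h with hv
    set a : Energy := (c (2 * k) * (2 * k).factorial) • mono 0 + volterra v with ha
    have hu' : u = ∑ m ∈ Finset.range (2 * k), c m • mono m + (volterra ^ (2 * k)) a := by
      rw [hu, show 2 * (k + 1) = 2 * k + 1 + 1 by ring, Finset.sum_range_succ,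
        Finset.sum_range_succ, ha, hv, mono_eq_volterra_pow (2 * k),
        mono_eq_volterra_pow (2 * k + 1)]
      simp only [map_add, map_smul, pow_succ, mul_apply_eq_comp, smul_smul]
      abel
    obtain ⟨hs, hd⟩ := ih hu'
    obtain ⟨a1, a2, a3⟩ := isWeakDeriv_mono_add_volterra (c (2 * k) * (2 * k).factorial) v
    obtain ⟨b1, b2, b3⟩ :=
      isWeakDeriv_mono_add_volterra (c (2 * k + 1) * (2 * k + 1).factorial) h
    rw [← ha] at a1 a2 a3
    rw [← hv] at b1 b2 b3
    have f0 : weakDeriv (2 * k) u.fst = a.fst := congrArg WithLp.fst hd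
    have g0 : weakDeriv (2 * k) u.snd = a.snd := congrArg WithLp.snd hd
    have f1 := isWeakDeriv_weakDeriv (hs.1 (2 * k) le_rfl)
    have g1 := isWeakDeriv_weakDeriv (hs.2.1 (2 * k) le_rfl)
    rw [f0] at f1
    rw [g0] at g1
    have f2 := f1.trans a1
    have g2 := g1.trans a2
    have f3 := f2.trans b2.neg
    have g3 := g2.trans b1.neg
    rw [neg_neg] at f3 g3
    refine ⟨⟨fun n hn => ?_, fun n hn => ?_, fun j hj => ?_⟩,
      WithLp.ofLp_injective 2 (Prod.ext f3.weakDeriv_eq g3.weakDeriv_eq)⟩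
    · rcases (by omega : n ≤ 2 * k ∨ n = 2 * k + 1 ∨ n = 2 * k + 1 + 1) with h | rfl | rfl
      exacts [hs.1 n h, ⟨_, f2⟩, ⟨_, f3⟩]
    · rcases (by omega : n ≤ 2 * k ∨ n = 2 * k + 1 ∨ n = 2 * k + 1 + 1) with h | rfl | rfl
      exacts [hs.2.1 n h, ⟨_, g2⟩, ⟨_, g3⟩]
    · rcases (by omega : j < k ∨ j = k) with h | rfl
      · exact hs.2.2 j h
      · rw [f0, g2.weakDeriv_eq]
        exact ⟨a3, b3.neg⟩

/-! ### The normalized eigenfunctions -/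

theorem deriv_profile_succ (m : ℕ) (ρ : ℝ) :
    deriv (profile (m + 1)) ρ = -((m + 1) * ((1 - ρ) ^ m + (1 + ρ) ^ m)) := by
  have h1 : HasDerivAt (fun ρ : ℝ => (1 - ρ) ^ (m + 1)) (((m + 1 : ℕ) : ℝ) * (1 - ρ) ^ m * (-1)) ρ :=
    ((hasDerivAt_id ρ).const_sub 1).pow (m + 1)
  have h2 : HasDerivAt (fun ρ : ℝ => (1 + ρ) ^ (m + 1)) (((m + 1 : ℕ) : ℝ) * (1 + ρ) ^ m * 1) ρ :=
    ((hasDerivAt_id ρ).const_add 1).pow (m + 1)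
  refine (h1.sub h2).deriv.trans ?_
  push_cast; ring

theorem eigval_succ (m : ℕ) : eigval (m + 1) = -m := by
  unfold eigval; push_cast; ring

/-- With `j = m + 1`, the eigenfunction has half-wave profile `-2j y^{j-1}`. -/
theorem rawMode_succ (m : ℕ) : rawMode (m + 1) = (-(2 * (m + 1)) : ℂ) • mono m := by
  apply energy_ext
  · filter_upwards [(memLp_of_continuous (continuous_modeFst (m + 1))).coeFn_toLp,
      mono_fst_ae m, Lp.coeFn_smul (-(2 * (m + 1)) : ℂ) (mono m).fst] with ρ h1 h2 h3
    refine h1.trans (Eq.trans ?_ h3.symm)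
    rw [Pi.smul_apply, h2, modeFst, deriv_profile_succ, eigval_succ, profile, monoFst]
    push_cast; simp only [smul_eq_mul]; ring
  · filter_upwards [(memLp_of_continuous (continuous_modeSnd (m + 1))).coeFn_toLp,
      mono_snd_ae m, Lp.coeFn_smul (-(2 * (m + 1)) : ℂ) (mono m).snd] with ρ h1 h2 h3
    refine h1.trans (Eq.trans ?_ h3.symm)
    rw [Pi.smul_apply, h2, modeSnd, deriv_profile_succ, monoSnd]
    push_cast; simp only [smul_eq_mul]; ring

theorem mono_ne_zero (m : ℕ) : mono m ≠ 0 := by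
  intro h
  have hz : (mono m).snd =ᵐ[unitMeasure] fun _ => 0 := by
    rw [h]
    filter_upwards [Lp.coeFn_zero ℂ 2 unitMeasure] with x hx using hx
  have hEq : EqOn (monoSnd m) (fun _ => 0) (Ioo 0 1) :=
    Measure.eqOn_open_of_ae_eq ((mono_snd_ae m).symm.trans hz) isOpen_Ioo
      (continuous_monoSnd m).continuousOn continuousOn_const
  have h2 := hEq (x := 1 / 2) (by constructor <;> norm_num)
  have h3 : monoSnd m (1 / 2) = ((((1 - 1 / 2) ^ m + (1 + 1 / 2) ^ m) / 2 : ℝ) : ℂ) := by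
    unfold monoSnd; push_cast; ring
  rw [h3] at h2
  have h4 : (((1 - 1 / 2) ^ m + (1 + 1 / 2) ^ m) / 2 : ℝ) = 0 := Complex.ofReal_eq_zero.1 h2
  have h5 : (0 : ℝ) < ((1 - 1 / 2) ^ m + (1 + 1 / 2) ^ m) / 2 := by positivity
  exact h5.ne' h4

theorem smul_mono_mem_sobolevSpace {k m : ℕ} (hm : m < 2 * k) (a : ℂ) :
    a • mono m ∈ sobolevSpace k ∧ diffOp k (a • mono m) = 0 := by
  refine mem_sobolevSpace_of_taylor (c := Pi.single m a) ?_
  rw [map_zero, add_zero, Finset.sum_eq_single_of_mem m (Finset.mem_range.2 hm)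
    (fun n _ hn => by rw [Pi.single_eq_of_ne hn, zero_smul]), Pi.single_eq_same]

theorem sobolevNorm_eq_norm {k : ℕ} {u : Energy} (h : diffOp k u = 0) : sobolevNorm k u = ‖u‖ := by
  rw [sobolevNorm, h, norm_zero]; simp [Real.sqrt_sq]

theorem norm_diffOp_le_sobolevNorm (k : ℕ) (u : Energy) : ‖diffOp k u‖ ≤ sobolevNorm k u :=
  Real.le_sqrt_of_sq_le (by nlinarith [sq_nonneg ‖u‖])

theorem sobolevNorm_le (k : ℕ) (u : Energy) : sobolevNorm k u ≤ ‖u‖ + ‖diffOp k u‖ :=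
  Real.sqrt_le_iff.2 ⟨by positivity, by nlinarith [norm_nonneg u, norm_nonneg (diffOp k u)]⟩

/-- `D^{2k}` annihilates `y^m` for `m < 2k`, so normalizing in `𝓗^{2k}` is the same as normalizing
in energy. -/
theorem exists_mode_eq {k m : ℕ} (hm : m < 2 * k) :
    ∃ b : ℂ, b ≠ 0 ∧ mode k (m + 1) = b • mono m ∧ ‖mode k (m + 1)‖ = 1 := by
  have ha : (-(2 * (m + 1)) : ℂ) ≠ 0 :=
    neg_ne_zero.2 (mul_ne_zero two_ne_zero (Nat.cast_add_one_ne_zero m))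
  have hN : sobolevNorm k (rawMode (m + 1)) = ‖rawMode (m + 1)‖ :=
    sobolevNorm_eq_norm (by rw [rawMode_succ]; exact (smul_mono_mem_sobolevSpace hm _).2)
  have h0 : ‖rawMode (m + 1)‖ ≠ 0 := by
    rw [rawMode_succ]; exact norm_ne_zero_iff.2 (smul_ne_zero ha (mono_ne_zero m))
  refine ⟨((‖rawMode (m + 1)‖⁻¹ : ℝ) : ℂ) * -(2 * (m + 1)), mul_ne_zero ?_ ha, ?_, ?_⟩
  · exact Complex.ofReal_ne_zero.2 (inv_ne_zero h0)
  · rw [mode, hN, mul_smul, ← rawMode_succ]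
  · rw [mode, hN, norm_smul, Complex.norm_real, norm_inv, norm_norm, inv_mul_cancel₀ h0]

theorem isAnalytic_smul_mono (a : ℂ) (m : ℕ) : IsAnalytic (a • mono m) := by
  refine ⟨fun ρ => a * monoFst m ρ, fun ρ => a * monoSnd m ρ, ?_, ?_, ?_, ?_⟩
  · exact ((contDiff_omega_iff_analyticOnNhd (𝕜 := ℝ)).1
      (contDiff_const.mul (contDiff_monoFst m))).mono (subset_univ _)
  · exact ((contDiff_omega_iff_analyticOnNhd (𝕜 := ℝ)).1
      (contDiff_const.mul (contDiff_monoSnd m))).mono (subset_univ _)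
  · filter_upwards [mono_fst_ae m, Lp.coeFn_smul a (mono m).fst] with ρ h1 h2
    refine h2.trans ?_
    rw [Pi.smul_apply, h1, smul_eq_mul]
  · filter_upwards [mono_snd_ae m, Lp.coeFn_smul a (mono m).snd] with ρ h1 h2
    refine h2.trans ?_
    rw [Pi.smul_apply, h1, smul_eq_mul]

theorem smul_mono_mem_generator_graph (hcl : preGenerator.IsClosable) (a : ℂ) (m : ℕ) :
    (a • mono m, (eigval (m + 1) : ℂ) • a • mono m) ∈ generator.graph := by
  rw [generator, ← hcl.graph_closure_eq_closure_graph, preGenerator_graph]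
  have := preGeneratorGraph.le_topologicalClosure
    (preGeneratorGraph.smul_mem a (mono_mem_preGeneratorGraph m))
  rw [eigval_succ, Complex.ofReal_neg, Complex.ofReal_natCast, smul_comm]
  exact this

theorem mode_properties (hcl : preGenerator.IsClosable) {k j : ℕ}
    (hj : j ∈ Finset.Icc 1 (2 * k)) :
    IsAnalytic (mode k j) ∧ mode k j ∈ kernelSpace k ∧ sobolevNorm k (mode k j) = 1 ∧
      mode k j ≠ 0 ∧ (mode k j, (eigval j : ℂ) • mode k j) ∈ generator.graph := by
  obtain ⟨m, rfl⟩ : ∃ m, j = m + 1 := ⟨j - 1, by have := (Finset.mem_Icc.1 hj).1; omega⟩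
  have hm : m < 2 * k := (Finset.mem_Icc.1 hj).2
  obtain ⟨b, hb, hmode, hn⟩ := exists_mode_eq hm
  have hs := smul_mono_mem_sobolevSpace hm b
  have hg := smul_mono_mem_generator_graph hcl b m
  have ha := isAnalytic_smul_mono b m
  rw [← hmode] at hs hg ha
  refine ⟨ha, hs, ?_, ?_, hg⟩
  · rw [sobolevNorm_eq_norm hs.2, hn]
  · rw [← norm_ne_zero_iff, hn]; exact one_ne_zero

/-! ### The decomposition and the decay estimates -/

theorem sum_Icc_one_eq_sum_range {M : Type*} [AddCommMonoid M] (f : ℕ → M) (n : ℕ) :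
    ∑ j ∈ Finset.Icc 1 n, f j = ∑ m ∈ Finset.range n, f (m + 1) := by
  induction n with
  | zero => simp
  | succ n ih => rw [Finset.sum_Icc_succ_top (by omega), ih, Finset.sum_range_succ]

theorem exists_decomposition {S : ℝ≥0 → Energy →L[ℂ] Energy} {C : ℝ} (hC : 0 < C)
    (hn : ∀ t, ‖S t‖ ≤ C * Real.exp (t / 2))
    (hS : ∀ t m, S t (mono m) = (Real.exp (-(m * t)) : ℂ) • mono m) (k : ℕ) :
    ∃ C : ℝ, 0 < C ∧ ∀ u ∈ sobolevSpace k, ∃ (c : ℕ → ℂ) (g : Energy),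
        g ∈ sobolevSpace k ∧
        u = ∑ j ∈ Finset.Icc 1 (2 * k), c j • mode k j + g ∧
        (∀ τ : ℝ≥0, S τ g ∈ sobolevSpace k ∧
          sobolevNorm k (S τ g) ≤ C * (Real.exp ((1 / 2 - 2 * k) * τ) * sobolevNorm k g)) ∧
        (∀ τ : ℝ≥0, S τ u ∈ sobolevSpace k ∧
          sobolevNorm k (S τ u) ≤
            C * (∑ j ∈ Finset.Icc 1 (2 * k), ‖c j‖ * Real.exp (eigval j * τ) +
              Real.exp ((1 / 2 - 2 * k) * τ) * sobolevNorm k u)) := by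
  set B : ℝ := (‖volterra ^ (2 * k)‖ + 1) * C with hB
  have hB0 : 0 < B := by positivity
  -- `B` controls the remainder and `1` the finite sum of modes.
  refine ⟨1 + B, by positivity, fun u hu => ?_⟩
  obtain ⟨c, hc⟩ := exists_taylor hu
  set h := diffOp k u with hh
  have hmode : ∀ m, ∃ b : ℂ, m < 2 * k → b ≠ 0 ∧ mode k (m + 1) = b • mono m ∧
      ‖mode k (m + 1)‖ = 1 := fun m => by
    by_cases hm : m < 2 * k
    · obtain ⟨b, hb⟩ := exists_mode_eq hm
      exact ⟨b, fun _ => hb⟩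
    · exact ⟨0, fun h => absurd h hm⟩
  choose b hb using hmode
  have hcm : ∀ m ∈ Finset.range (2 * k), (c m / b m) • mode k (m + 1) = c m • mono m := by
    intro m hm
    obtain ⟨h1, h2, -⟩ := hb m (Finset.mem_range.1 hm)
    rw [h2, smul_smul, div_mul_cancel₀ _ h1]
  have hg := mem_sobolevSpace_of_taylor (k := k) (u := (volterra ^ (2 * k)) h) (h := h) (c := 0)
    (by simp)
  -- `d τ` will be `D^{2k}` of the evolved remainder, and `V^{2k} (d τ)` that remainder itself.
  let d : ℝ≥0 → Energy := fun τ => (Real.exp (-((2 * k : ℕ) * τ)) : ℂ) • S τ h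
  have hSg : ∀ τ, S τ ((volterra ^ (2 * k)) h) = (volterra ^ (2 * k)) (d τ) := fun τ => by
    rw [semigroup_volterra_pow hS, map_smul]
  have hd : ∀ τ : ℝ≥0, ‖d τ‖ ≤ C * Real.exp ((1 / 2 - 2 * k) * τ) * ‖h‖ := by
    intro τ
    rw [norm_smul, Complex.norm_real, Real.norm_of_nonneg (Real.exp_pos _).le]
    have e : Real.exp ((1 / 2 - 2 * k) * τ) =
        Real.exp (-((2 * k : ℕ) * τ)) * Real.exp (τ / 2) := by
      rw [← Real.exp_add]; congr 1; push_cast; ring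
    have h1 := ((S τ).le_opNorm h).trans (mul_le_mul_of_nonneg_right (hn τ) (norm_nonneg h))
    refine (mul_le_mul_of_nonneg_left h1 (Real.exp_pos _).le).trans (le_of_eq ?_)
    rw [e]; ring
  have hdB : ∀ τ : ℝ≥0, ‖(volterra ^ (2 * k)) (d τ)‖ + ‖d τ‖ ≤
      B * (Real.exp ((1 / 2 - 2 * k) * τ) * ‖h‖) := fun τ => by
    calc _ ≤ ‖volterra ^ (2 * k)‖ * ‖d τ‖ + ‖d τ‖ := by
          gcongr; exact (volterra ^ (2 * k)).le_opNorm _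
      _ = (‖volterra ^ (2 * k)‖ + 1) * ‖d τ‖ := by ring
      _ ≤ (‖volterra ^ (2 * k)‖ + 1) * (C * Real.exp ((1 / 2 - 2 * k) * τ) * ‖h‖) := by
          gcongr; exact hd τ
      _ = _ := by rw [hB]; ring
  -- Mode `j` carries the Taylor coefficient of `y^{j-1}`, divided by the normalization factor; `g`
  -- is the integral remainder.
  refine ⟨fun j => c (j - 1) / b (j - 1), (volterra ^ (2 * k)) h, hg.1, ?_, fun τ => ?_,
    fun τ => ?_⟩
  · rw [sum_Icc_one_eq_sum_range]
    simp only [Nat.add_sub_cancel]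
    rw [Finset.sum_congr rfl hcm]
    exact hc
  · have ht := mem_sobolevSpace_of_taylor (k := k) (u := S τ ((volterra ^ (2 * k)) h)) (h := d τ)
      (c := 0) (by rw [hSg]; simp)
    refine ⟨ht.1, (sobolevNorm_le k _).trans ?_⟩
    rw [ht.2, hSg]
    refine (hdB τ).trans ?_
    -- Since `D^{2k} g = h`, the bound in terms of `‖h‖` is one in terms of the norm of `g`.
    have hle : ‖h‖ ≤ sobolevNorm k ((volterra ^ (2 * k)) h) := by
      conv_lhs => rw [← hg.2]
      exact norm_diffOp_le_sobolevNorm k _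
    gcongr
    linarith
  · have hSu : S τ u = ∑ m ∈ Finset.range (2 * k), (c m * Real.exp (-(m * τ))) • mono m +
        (volterra ^ (2 * k)) (d τ) := by
      conv_lhs => rw [hc]
      rw [map_add, map_sum, hSg]
      congr 1
      refine Finset.sum_congr rfl fun m _ => ?_
      rw [map_smul, hS, smul_smul]
    have ht := mem_sobolevSpace_of_taylor hSu
    refine ⟨ht.1, (sobolevNorm_le k _).trans ?_⟩
    rw [ht.2]
    have hsum : ‖∑ m ∈ Finset.range (2 * k), (c m * Real.exp (-(m * τ))) • mono m‖ ≤
        ∑ j ∈ Finset.Icc 1 (2 * k), ‖c (j - 1) / b (j - 1)‖ * Real.exp (eigval j * τ) := by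
      rw [sum_Icc_one_eq_sum_range]
      refine norm_sum_le_of_le _ fun m hm => ?_
      rw [mul_comm, mul_smul, ← hcm m hm, norm_smul, norm_smul,
        (hb m (Finset.mem_range.1 hm)).2.2, eigval_succ, Complex.norm_real,
        Real.norm_of_nonneg (Real.exp_pos _).le, mul_one, mul_comm, neg_mul]
      exact le_rfl
    have h1 : ‖S τ u‖ ≤ ∑ j ∈ Finset.Icc 1 (2 * k),
        ‖c (j - 1) / b (j - 1)‖ * Real.exp (eigval j * τ) + ‖(volterra ^ (2 * k)) (d τ)‖ := by
      rw [hSu]; exact (norm_add_le _ _).trans (by gcongr)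
    have h2 := hdB τ
    have h3 : Real.exp ((1 / 2 - 2 * k) * τ) * ‖h‖ ≤
        Real.exp ((1 / 2 - 2 * k) * τ) * sobolevNorm k u := by
      gcongr; exact norm_diffOp_le_sobolevNorm k u
    have h4 : 0 ≤ Real.exp ((1 / 2 - 2 * k) * τ) * ‖h‖ := by positivity
    have h5 : 0 ≤ ∑ j ∈ Finset.Icc 1 (2 * k),
        ‖c (j - 1) / b (j - 1)‖ * Real.exp (eigval j * τ) :=
      Finset.sum_nonneg fun j _ => by positivity
    nlinarith [mul_le_mul_of_nonneg_left h3 hB0.le, mul_nonneg hB0.le h5]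

end FreeWave

end

open FreeWave in
theorem theorem3p6 :
    -- `L₀` is well defined and generates a unique semigroup `S₀`
    preGenerator.IsClosable ∧
    (∃! S : ℝ≥0 → Energy →L[ℂ] Energy, IsSemigroupGeneratedBy S generator) ∧
    ∀ S : ℝ≥0 → Energy →L[ℂ] Energy, IsSemigroupGeneratedBy S generator →
    ∀ k : ℕ,
      -- normalized analytic eigenfunctions in the kernel of `D^{2k}`
      (∀ j ∈ Finset.Icc 1 (2 * k),
        IsAnalytic (mode k j) ∧ mode k j ∈ kernelSpace k ∧ sobolevNorm k (mode k j) = 1 ∧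
        mode k j ≠ 0 ∧ (mode k j, (eigval j : ℂ) • mode k j) ∈ generator.graph) ∧
      -- the decomposition and the estimates, with a constant depending only on `k`
      ∃ C : ℝ, 0 < C ∧ ∀ u ∈ sobolevSpace k, ∃ (c : ℕ → ℂ) (g : Energy),
        g ∈ sobolevSpace k ∧
        u = ∑ j ∈ Finset.Icc 1 (2 * k), c j • mode k j + g ∧
        (∀ τ : ℝ≥0, S τ g ∈ sobolevSpace k ∧
          sobolevNorm k (S τ g) ≤ C * (Real.exp ((1 / 2 - 2 * k) * τ) * sobolevNorm k g)) ∧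
        (∀ τ : ℝ≥0, S τ u ∈ sobolevSpace k ∧
          sobolevNorm k (S τ u) ≤
            C * (∑ j ∈ Finset.Icc 1 (2 * k), ‖c j‖ * Real.exp (eigval j * τ) +
              Real.exp ((1 / 2 - 2 * k) * τ) * sobolevNorm k u)) := by
  obtain ⟨hcl, S₀, C, hC, hn, hS, hgen, huniq⟩ := exists_free_semigroup
  refine ⟨hcl, ⟨S₀, hgen, huniq⟩, fun S hSgen k => ⟨fun j hj => mode_properties hcl hj, ?_⟩⟩
  obtain rfl := huniq S hSgen
  exact exists_decomposition hC hn hS k
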